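/- **Conventions.** For a partially ordered real vector space $E$ let $\overline{E}=E\cup\{\infty\}$, where $\infty$ is a new largest element, $\infty+x=x+\infty=\infty$, $r\cdot\infty=\infty$ for real $r>0$, and $0\cdot\infty=0$; put $\overline{E^+}=E^+\cup\{\infty\}$. Let $X$ be a locally compact Hausdorff space with Borel $\sigma$-algebra $\mathcal B$. A map $\mu:\mathcal B\to\overline{E^+}$ is a *measure* if $\mu(\emptyset)=0$ and $\mu\big(\bigcup_{n}\Delta_n\big)=\bigvee_{N}\sum_{n=1}^N\mu(\Delta_n)$ in $\overline E$ for all pairwise disjoint sequences $(\Delta_n)$ in $\mathcal B$. It is *finite* if $\mu(X)\in E$, and it is a *regular Borel measure* if $\mu(K)\in E$ for all compact $K$, $\mu(V)=\bigvee\{\mu(K):K\text{ compact},\,K\subseteq V\}$ in $\overline E$ for all open $V$, and $\mu(\Delta)=\bigwedge\{\mu(V):V\text{ open},\,\Delta\subseteq V\}$ in $\overline E$ for all $\Delta\in\mathcal B$. The order integral of an elementary function $\varphi=\sum_{i=1}^n r_i1_{\Delta_i}$ (with $r_i\in[0,\infty)$, $\Delta_i\in\mathcal B$) is $\int^{o}\varphi\,d\mu=\sum_i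 r_i\mu(\Delta_i)$. The order integral of a measurable $f:X\to[0,\infty]$ is $\int^{o}f\,d\mu=\bigvee_n\int^{o}\varphi_n\,d\mu$ in $\overline{E}$ for a sequence of elementary functions with $\varphi_n\uparrow f$ pointwise. $\mathcal L^1(\mu)$ is the set of measurable $f:X\to\mathbb R$ such that $\int^{o}|f|\,d\mu\in E$; for such $f$, $\int^{o}f\,d\mu=\int^{o}f^+d\mu-\int^{o}f^-d\mu\in E$. $C_c(X)$ and $C_0(X)$ are the real-valued continuous functions on $X$ with compact support, resp. vanishing at infinity. For $S\subseteq X$, $f\prec S$ means that $f\in C_c(X)$, $0\le f\le1$ and $\operatorname{supp}f\subseteq S$; $S\prec f$ means that $f\in C_c(X)$, $0\le f\le 1$ and $f=1$ on $S$. SOT denotes the strong operator topology. **Theorem.** Let $X$ be a locally compact Hausdorff space, $H$ a complex Hilbert space, and $\pi:C_0(X)\to B(H)_{\mathrm{sa}}$ a positive (real linear, not necessarily multiplicative) operator. Let $L$ be an SOT-closed complex linear subspace of $B(H)$ that contains $\pi(C_0(X))$, and let $L_{\mathrm{sa}}$ be the real vector space of the self-adjoint operators in $L$, with the partial ordering inherited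 from $B(H)_{\mathrm{sa}}$. 1. There is a unique regular Borel measure $\mu:\mathcal B\to\overline{L_{\mathrm{sa}}^+}$ such that $\pi(f)=\int^{o}f\,d\mu$ for all $f\in C_c(X)$. The measure $\mu$ is finite, and $\pi(f)=\int^{o}f\,d\mu$ also holds for all $f\in C_0(X)$. 2. If $V\subseteq X$ is open and non-empty, then $\mu(V)=\bigvee\{\pi(f):f\prec V\}$ in $L_{\mathrm{sa}}$. If $K\subseteq X$ is compact, then $\mu(K)=\bigwedge\{\pi(f):K\prec f\}$ in $L_{\mathrm{sa}}$. 3. If $(\Delta_n)_{n\geq 1}$ is a pairwise disjoint sequence in $\mathcal B$, then $\mu\big(\bigcup_{n}\Delta_n\big)x=\sum_{n=1}^\infty\mu(\Delta_n)x$ in the norm topology of $H$, for all $x\in H$. 4. Extend $\pi$ to $\mathcal L^1(\mu)$ by $\pi(f)=\int^{o}f\,d\mu\in L_{\mathrm{sa}}$. For $x\in H$ and $\Delta\in\mathcal B$ put $\mu_x(\Delta)=\langle\mu(\Delta)x,x\rangle$. Then $\mu_x$ is a finite (positive) regular Borel measure on $X$. If $f\in\mathcal L^1(\mu)$, then $f$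 is $\mu_x$-integrable for all $x\in H$, and $\pi(f)$ is the unique element of $B(H)$ such that $\langle\pi(f)x,x\rangle=\int_X f\,d\mu_x$ for all $x\in H$. 5. The SOT-closed real linear subspaces of $B(H)$ that are generated by the following seven sets are equal: $\{\pi(f):f\in C_c(X)\}$; $\{\pi(f):f\in C_0(X)\}$; $\{\pi(f):f:X\to\mathbb R\text{ bounded and Borel measurable}\}$; $\{\pi(f):f\in\mathcal L^1(\mu)\}$; $\{\mu(V):V\subseteq X\text{ open}\}$; $\{\mu(K):K\subseteq X\text{ compact}\}$; $\{\mu(\Delta):\Delta\in\mathcal B\}$. The SOT-closed complex linear subspaces of $B(H)$ that are generated by these seven sets are equal as well. -/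

import Mathlib

open MeasureTheory Topology Filter
open scoped NNReal ENNReal ZeroAtInfty

noncomputable section

namespace OrderRiesz

/-! ### Measures and order integrals with values in a partially ordered vector space

For a partially ordered vector space `E`, the extended space `E ∪ {∞}` is `WithTop E`: it has a
new largest element `⊤`, and `⊤ + x = x + ⊤ = ⊤`. -/

section Measure

variable {X : Type*} [MeasurableSpace X] {E : Type*} [AddCommGroup E] [PartialOrder E]

variable (X E) in
/-- A positive `E ∪ {∞}`-valued measure on the σ-algebra of `X`. As for Mathlib's vector measures,
it is given the value `0` on non-measurable sets, so that two measures that agree on the σ-algebra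
are equal. -/
structure PosMeasure where
  toFun : Set X → WithTop E
  not_measurable' : ∀ Δ, ¬ MeasurableSet Δ → toFun Δ = 0
  nonneg' : ∀ Δ, 0 ≤ toFun Δ
  empty' : toFun ∅ = 0
  isLUB_iUnion' : ∀ Δ : ℕ → Set X, (∀ n, MeasurableSet (Δ n)) →
    Pairwise (Function.onFun Disjoint Δ) →
    IsLUB (Set.range fun N : ℕ => ∑ n ∈ Finset.range N, toFun (Δ n)) (toFun (⋃ n, Δ n))

instance : CoeFun (PosMeasure X E) (fun _ => Set X → WithTop E) := ⟨PosMeasure.toFun⟩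

namespace PosMeasure

/-- The measure is finite: `μ(X)` is an element of `E`. -/
def IsFinite (μ : PosMeasure X E) : Prop := μ Set.univ ≠ ⊤

/-- The value `μ(Δ)` as an element of `E` (and `0` if `μ(Δ) = ∞`). -/
def value (μ : PosMeasure X E) (Δ : Set X) : E := (μ Δ).untopD 0

/-- The measure is finite on compact sets. -/
def IsBorel [TopologicalSpace X] (μ : PosMeasure X E) : Prop :=
  ∀ K : Set X, IsCompact K → μ K ≠ ⊤

/-- Inner regularity at `Δ`; the supremum is taken in `E ∪ {∞}`. -/
def InnerRegularAt [TopologicalSpace X] (μ : PosMeasure X E) (Δ : Set X) : Prop :=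
  IsLUB {T | ∃ K : Set X, IsCompact K ∧ K ⊆ Δ ∧ T = μ K} (μ Δ)

/-- Outer regularity at `Δ`; the infimum is taken in `E ∪ {∞}`. -/
def OuterRegularAt [TopologicalSpace X] (μ : PosMeasure X E) (Δ : Set X) : Prop :=
  IsGLB {T | ∃ V : Set X, IsOpen V ∧ Δ ⊆ V ∧ T = μ V} (μ Δ)

/-- A regular Borel measure: finite on compact sets, inner regular at all open sets, and outer
regular at all Borel sets. -/
structure IsRegularBorel [TopologicalSpace X] (μ : PosMeasure X E) : Prop where
  isBorel : μ.IsBorel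
  innerRegularAt : ∀ V : Set X, IsOpen V → μ.InnerRegularAt V
  outerRegularAt : ∀ Δ : Set X, MeasurableSet Δ → μ.OuterRegularAt Δ

variable [Module ℝ E]

/-- The action of `[0, ∞)` on `E ∪ {∞}`, with `r • ∞ = ∞` for `r > 0` and `0 • ∞ = 0`. -/
def extSMul (r : ℝ≥0) : WithTop E → WithTop E
  | ⊤ => if r = 0 then 0 else ⊤
  | (T : E) => (((r : ℝ) • T : E) : WithTop E)

/-- The order integral of an elementary function. -/
def elemIntegral (μ : PosMeasure X E) (φ : SimpleFunc X ℝ≥0) : WithTop E :=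
  ∑ r ∈ φ.range, extSMul r (μ (φ ⁻¹' {r}))

/-- `I` is the supremum in `E ∪ {∞}` of the order integrals of some sequence of elementary
functions that increases pointwise to `f`. -/
def IsOrderIntegral (μ : PosMeasure X E) (f : X → ℝ≥0∞) (I : WithTop E) : Prop :=
  ∃ φ : ℕ → SimpleFunc X ℝ≥0, Monotone φ ∧ (∀ x, ⨆ n, (φ n x : ℝ≥0∞) = f x) ∧
    IsLUB (Set.range fun n => μ.elemIntegral (φ n)) I

open Classical in
/-- The order integral of a measurable function with values in `[0, ∞]`: choose elementary
functions that increase to `f` and take the supremum of their integrals. (When no such supremum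
exists, which cannot occur for measurable `f` if `E` is σ-monotone complete, the value is `⊤`;
hence a finite order integral is always a genuine one.) -/
def orderIntegral (μ : PosMeasure X E) (f : X → ℝ≥0∞) : WithTop E :=
  if h : ∃ I, μ.IsOrderIntegral f I then h.choose else ⊤

/-- The space of (finite-valued) measurable functions such that the order integral of `|f|` is
finite. -/
def L1 (μ : PosMeasure X E) : Set (X → ℝ) :=
  {f | Measurable f ∧ μ.orderIntegral (fun x => ENNReal.ofReal |f x|) ≠ ⊤}

/-- The order integral of a real-valued function (in `L1`): the difference of the order integrals
of its positive and negative parts. -/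
def integral (μ : PosMeasure X E) (f : X → ℝ) : E :=
  (μ.orderIntegral fun x => ENNReal.ofReal (f x)).untopD 0 -
    (μ.orderIntegral fun x => ENNReal.ofReal (-f x)).untopD 0

end PosMeasure

end Measure

/-! ### Functions -/

section Functions

variable {X : Type*} [TopologicalSpace X]

/-- `f ≺ S`: `f` is in `C_c(X)`, `0 ≤ f ≤ 1`, and the support of `f` is contained in `S`. -/
def PrecSet (f : C₀(X, ℝ)) (S : Set X) : Prop :=
  HasCompactSupport f ∧ (∀ x, 0 ≤ f x ∧ f x ≤ 1) ∧ tsupport f ⊆ S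

/-- `S ≺ f`: `f` is in `C_c(X)`, `0 ≤ f ≤ 1`, and `f = 1` on `S`. -/
def SetPrec (S : Set X) (f : C₀(X, ℝ)) : Prop :=
  HasCompactSupport f ∧ (∀ x, 0 ≤ f x ∧ f x ≤ 1) ∧ ∀ x ∈ S, f x = 1

end Functions

/-! ### Hilbert space operators -/

section Operators

variable {H : Type*} [NormedAddCommGroup H] [InnerProductSpace ℂ H]

/-- `S` is closed in the strong operator topology (the topology of pointwise convergence). -/
def IsSOTClosed (S : Set (H →L[ℂ] H)) : Prop :=
  IsClosed (ContinuousLinearMap.toPointwiseConvergenceCLM ℂ (RingHom.id ℂ) H H '' S)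

/-- The SOT-closed `𝕜`-linear subspace generated by `S`: the intersection of all SOT-closed
`𝕜`-linear subspaces that contain `S`. It is used for `𝕜 = ℝ` and for `𝕜 = ℂ`. -/
def sotSpan (𝕜 : Type*) [Semiring 𝕜] [Module 𝕜 (H →L[ℂ] H)] (S : Set (H →L[ℂ] H)) :
    Submodule 𝕜 (H →L[ℂ] H) :=
  sInf {M | IsSOTClosed (M : Set (H →L[ℂ] H)) ∧ S ⊆ M}

variable [CompleteSpace H]

/-- The real vector space of the self-adjoint operators in `L`; it carries the partial ordering
inherited from the usual (Loewner) ordering of operators. -/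
def saPart (L : Submodule ℂ (H →L[ℂ] H)) : Submodule ℝ (H →L[ℂ] H) :=
  L.restrictScalars ℝ ⊓ selfAdjoint.submodule ℝ (H →L[ℂ] H)

variable {X : Type*} [TopologicalSpace X]

/-- An operator `π : C₀(X) → B(H)_sa` with range in `L`, as an operator into `L_sa`. -/
def toSaPart (L : Submodule ℂ (H →L[ℂ] H)) (π : C₀(X, ℝ) →ₗ[ℝ] selfAdjoint (H →L[ℂ] H))
    (hL : ∀ f, (π f : H →L[ℂ] H) ∈ L) : C₀(X, ℝ) →ₗ[ℝ] saPart L where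
  toFun f := ⟨π f, hL f, (π f).2⟩
  map_add' f g := by ext1; simp
  map_smul' r f := by ext1; simp

variable [MeasurableSpace X]

/-- `μ` represents `π` on the set of functions `S`: for every `f ∈ S`, the order integral of `f`
is defined, and it equals `π(f)`. -/
def RepresentsOn {E : Type*} [AddCommGroup E] [PartialOrder E] [Module ℝ E]
    (μ : PosMeasure X E) (π : C₀(X, ℝ) → E) (S : Set C₀(X, ℝ)) : Prop :=
  ∀ f ∈ S, ⇑f ∈ μ.L1 ∧ π f = μ.integral f

/-- The seven sets of operators that are associated with `π : C₀(X) → L_sa` and a (finite) measure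
`μ` with values in `L_sa`: the images of `C_c(X)` and `C₀(X)` under `π`; the order integrals of the
bounded measurable functions and of the functions in `L1`; and the measures of all open, of all
compact, and of all Borel subsets of `X`. -/
def sevenSets {L : Submodule ℂ (H →L[ℂ] H)} (π : C₀(X, ℝ) →ₗ[ℝ] saPart L)
    (μ : PosMeasure X (saPart L)) : Fin 7 → Set (H →L[ℂ] H) :=
  ![{T | ∃ f : C₀(X, ℝ), HasCompactSupport f ∧ T = π f},
    {T | ∃ f : C₀(X, ℝ), T = π f},
    {T | ∃ f : X → ℝ, Measurable f ∧ (∃ C : ℝ, ∀ x, |f x| ≤ C) ∧ T = μ.integral f},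
    {T | ∃ f ∈ μ.L1, T = μ.integral f},
    {T | ∃ V : Set X, IsOpen V ∧ T = μ.value V},
    {T | ∃ K : Set X, IsCompact K ∧ T = μ.value K},
    {T | ∃ Δ : Set X, MeasurableSet Δ ∧ T = μ.value Δ}]

end Operators

end OrderRiesz

end

/-! Everything is tested on quadratic forms. In `saPart L` the order is the pointwise order of the
forms `x ↦ ⟨x, T x⟩`, and the form determines `T` (`saPart_le_iff`, `saPart_ext_quadForm`). An
operator whose form is the pointwise supremum of the forms of a family is therefore the order
supremum of that family (`isLUB_of_quadForm`). Order statements thus reduce to statements about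
scalar measures, once operators with the required forms are known to exist in `L`.

For each `x` the Riesz theorem applied to `f ↦ ⟨x, π(f) x⟩` gives a regular measure. It is finite
because a positive `π` is bounded (`exists_norm_map_le`). The crux is `exists_value`: a Borel set
`Δ` needs an operator in `L` with form `x ↦ μ_x(Δ)`. It is obtained as a strong limit of operators
`π(h)`, `h ∈ C_c(X)`, indexed by pairs `(F, n)`, where `h` is within `1/(n+1)` of the indicator of
`Δ` in `L¹(μ_x)` for every `x` in the finite set `F`. The inequality `‖T x‖² ≤ ‖T‖ ⟨x, T x⟩` for `T
≥ 0` (`norm_apply_sq_le`) turns `L¹` estimates into strong convergence, and SOT-closedness keeps the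
limit in `L`.

The same inequality gives strong σ-additivity and strong limits of bounded increasing sequences.
With monotone convergence for each `μ_x`, order integrals are identified by their forms. Since all
values and integrals arise as strong limits, the seven generated subspaces coincide.

Uniqueness uses no scalar measures: if `K ≺ f ≺ V`, then `ν(K) ≤ π(f) ≤ μ(V)`. Inner regularity
gives `ν(V) ≤ μ(V)`, symmetry gives equality on open sets, and outer regularity carries it to all
Borel sets. -/

noncomputable section

namespace OrderRiesz

/-! ### Quadratic forms of operators -/

section QuadForm

variable {H : Type*} [NormedAddCommGroup H] [InnerProductSpace ℂ H]

/-- The real part of `⟨x, T x⟩`. -/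
def quadForm (T : H →L[ℂ] H) (x : H) : ℝ := (inner ℂ x (T x)).re

@[simp] lemma quadForm_zero (x : H) : quadForm (0 : H →L[ℂ] H) x = 0 := by simp [quadForm]

lemma quadForm_add (S T : H →L[ℂ] H) (x : H) :
    quadForm (S + T) x = quadForm S x + quadForm T x := by simp [quadForm]

lemma quadForm_sub (S T : H →L[ℂ] H) (x : H) :
    quadForm (S - T) x = quadForm S x - quadForm T x := by simp [quadForm]

lemma quadForm_smul (r : ℝ) (T : H →L[ℂ] H) (x : H) :
    quadForm (r • T) x = r * quadForm T x := by
  simp only [quadForm, smul_apply]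
  rw [← Complex.coe_smul, inner_smul_right]
  simp

lemma quadForm_sum {ι : Type*} (s : Finset ι) (T : ι → H →L[ℂ] H) (x : H) :
    quadForm (∑ i ∈ s, T i) x = ∑ i ∈ s, quadForm (T i) x := by
  simp [quadForm]

lemma quadForm_le_norm (T : H →L[ℂ] H) (x : H) : quadForm T x ≤ ‖T‖ * ‖x‖ ^ 2 := by
  calc quadForm T x ≤ ‖inner ℂ x (T x)‖ := Complex.re_le_norm _
    _ ≤ ‖x‖ * ‖T x‖ := norm_inner_le_norm _ _
    _ ≤ ‖x‖ * (‖T‖ * ‖x‖) := by gcongr; exact T.le_opNorm x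
    _ = _ := by ring

lemma tendsto_quadForm {ι : Type*} {l : Filter ι} {T : ι → H →L[ℂ] H} {S : H →L[ℂ] H} {x : H}
    (h : Tendsto (fun i => T i x) l (𝓝 (S x))) :
    Tendsto (fun i => quadForm (T i) x) l (𝓝 (quadForm S x)) :=
  (Complex.continuous_re.tendsto _).comp (tendsto_const_nhds.inner h)

lemma quadForm_nonneg {T : H →L[ℂ] H} (hT : 0 ≤ T) (x : H) : 0 ≤ quadForm T x :=
  ((ContinuousLinearMap.nonneg_iff_isPositive T).1 hT).re_inner_nonneg_right x

/-- Complex polarization. No self-adjointness is needed, so uniqueness of `π(f)` holds in all of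
`B(H)`. -/
lemma eq_of_inner_apply_eq {S T : H →L[ℂ] H} (h : ∀ x, inner ℂ x (S x) = inner ℂ x (T x)) :
    S = T := by
  rw [← ContinuousLinearMap.coe_inj, ← sub_eq_zero]
  refine inner_map_self_eq_zero _ |>.1 fun x => ?_
  have h' : inner ℂ (S x) x = inner ℂ (T x) x := by
    rw [← inner_conj_symm, h x, inner_conj_symm]
  rw [LinearMap.sub_apply, inner_sub_left, sub_eq_zero]
  exact h'

variable [CompleteSpace H]

lemma inner_eq_quadForm {T : H →L[ℂ] H} (hT : IsSelfAdjoint T) (x : H) :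
    inner ℂ x (T x) = (quadForm T x : ℂ) := by
  refine (Complex.conj_eq_iff_re.mp ?_).symm
  rw [inner_conj_symm]
  exact hT.isSymmetric x x

lemma nonneg_of_quadForm {T : H →L[ℂ] H} (hT : IsSelfAdjoint T) (h : ∀ x, 0 ≤ quadForm T x) :
    0 ≤ T := by
  rw [ContinuousLinearMap.nonneg_iff_isPositive, ContinuousLinearMap.isPositive_iff']
  refine ⟨hT, fun x => ?_⟩
  have : inner ℂ (T x) x = inner ℂ x (T x) := hT.isSymmetric x x
  rw [this, inner_eq_quadForm hT]
  exact_mod_cast h x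

/-- Write `T = A* A`; then `‖A* A x‖² ≤ ‖A*‖² ‖A x‖² = ‖T‖ ⟨x, T x⟩`. This upgrades convergence of
forms to strong convergence. -/
lemma norm_apply_sq_le {T : H →L[ℂ] H} (hT : 0 ≤ T) (x : H) :
    ‖T x‖ ^ 2 ≤ ‖T‖ * quadForm T x := by
  obtain ⟨A, rfl⟩ := CStarAlgebra.nonneg_iff_eq_star_mul_self.1 hT
  have h1 : quadForm (star A * A) x = ‖A x‖ ^ 2 := by
    simp only [quadForm, mul_apply_eq_comp, ContinuousLinearMap.star_eq_adjoint,
      ContinuousLinearMap.adjoint_inner_right]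
    rw [inner_self_eq_norm_sq_to_K]
    norm_cast
  rw [h1, CStarRing.norm_star_mul_self, mul_apply_eq_comp]
  calc ‖star A (A x)‖ ^ 2 ≤ (‖star A‖ * ‖A x‖) ^ 2 := by
        gcongr; exact (star A).le_opNorm _
    _ = _ := by rw [norm_star]; ring

variable {L : Submodule ℂ (H →L[ℂ] H)}

lemma isSelfAdjoint_of_saPart (T : saPart L) : IsSelfAdjoint (T : H →L[ℂ] H) := T.2.2

/-- Positivity is self-adjointness together with a nonnegative form; the first is automatic in
`saPart L`. -/
lemma saPart_le_iff {S T : saPart L} :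
    S ≤ T ↔ ∀ x, quadForm (S : H →L[ℂ] H) x ≤ quadForm (T : H →L[ℂ] H) x := by
  rw [← Subtype.coe_le_coe, ← sub_nonneg]
  constructor
  · intro h x
    have := quadForm_nonneg h x
    rw [quadForm_sub] at this
    linarith
  · intro h
    refine nonneg_of_quadForm ((isSelfAdjoint_of_saPart T).sub (isSelfAdjoint_of_saPart S))
      fun x => ?_
    rw [quadForm_sub]
    linarith [h x]

lemma saPart_ext_quadForm {S T : saPart L}
    (h : ∀ x, quadForm (S : H →L[ℂ] H) x = quadForm (T : H →L[ℂ] H) x) : S = T :=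
  le_antisymm (saPart_le_iff.2 fun x => (h x).le) (saPart_le_iff.2 fun x => (h x).ge)

end QuadForm

instance {H : Type*} [NormedAddCommGroup H] [InnerProductSpace ℂ H] [CompleteSpace H]
    (L : Submodule ℂ (H →L[ℂ] H)) : PosSMulMono ℝ (saPart L) where
  smul_le_smul_of_nonneg_left r hr S T hST := saPart_le_iff.2 fun x => by
    simpa only [Submodule.coe_smul, quadForm_smul] using
      mul_le_mul_of_nonneg_left (saPart_le_iff.1 hST x) hr

/-! ### Strong operator limits -/

section SOT

variable {H : Type*} [NormedAddCommGroup H] [InnerProductSpace ℂ H]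

lemma IsSOTClosed.mem_of_tendsto {S : Set (H →L[ℂ] H)} (hS : IsSOTClosed S) {ι : Type*}
    {l : Filter ι} [l.NeBot] {T : ι → H →L[ℂ] H} {A : H →L[ℂ] H} (hT : ∀ i, T i ∈ S)
    (h : ∀ x, Tendsto (fun i => T i x) l (𝓝 (A x))) : A ∈ S := by
  have : Tendsto (fun i => ContinuousLinearMap.toPointwiseConvergenceCLM ℂ (RingHom.id ℂ) H H (T i))
      l (𝓝 (ContinuousLinearMap.toPointwiseConvergenceCLM ℂ (RingHom.id ℂ) H H A)) :=
    PointwiseConvergenceCLM.tendsto_iff_forall_tendsto.2 h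
  obtain ⟨B, hB, hBA⟩ := IsClosed.mem_of_tendsto hS this
    (Eventually.of_forall fun i => Set.mem_image_of_mem _ (hT i))
  have : B = A := ContinuousLinearMap.ext fun x => DFunLike.congr_fun hBA x
  exact this ▸ hB

/-- Finite sets of vectors together with a precision, directed by refinement. -/
lemma tendsto_of_norm_sq_le {C : ℝ} {T : Finset H × ℕ → H →L[ℂ] H} {A : H →L[ℂ] H}
    (h : ∀ F : Finset H, ∀ n : ℕ, ∀ x ∈ F, ‖T (F, n) x - A x‖ ^ 2 ≤ C / (n + 1)) (x : H) :
    Tendsto (fun i => T i x) atTop (𝓝 (A x)) := by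
  rw [tendsto_iff_norm_sub_tendsto_zero]
  have h1 : Tendsto (fun i : Finset H × ℕ => Real.sqrt (C / ((i.2 : ℝ) + 1))) atTop (𝓝 0) := by
    have h2 : Tendsto (fun n : ℕ => Real.sqrt (C / ((n : ℝ) + 1))) atTop (𝓝 0) := by
      have := (Real.continuous_sqrt.tendsto 0).comp
        (tendsto_const_div_atTop_nhds_zero_nat C |>.comp (tendsto_add_atTop_nat 1))
      simpa [Function.comp_def] using this
    rw [← prod_atTop_atTop_eq]
    exact h2.comp tendsto_snd
  refine squeeze_zero' (Eventually.of_forall fun i => norm_nonneg _) ?_ h1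
  -- Beyond the index `({x}, 0)` the finite set contains `x`, so the estimate applies to this
  -- vector.
  filter_upwards [eventually_ge_atTop (({x} : Finset H), 0)] with i hi
  refine Real.le_sqrt_of_sq_le (h i.1 i.2 x (hi.1 (by simp)))

lemma isSOTClosed_sInter {𝒮 : Set (Set (H →L[ℂ] H))} (h : ∀ S ∈ 𝒮, IsSOTClosed S) :
    IsSOTClosed (⋂₀ 𝒮) := by
  have hinj : Function.Bijective
      (ContinuousLinearMap.toPointwiseConvergenceCLM ℂ (RingHom.id ℂ) H H) :=
    ⟨fun S T hST => ContinuousLinearMap.ext fun x => DFunLike.congr_fun hST x, fun T => ⟨T, rfl⟩⟩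
  unfold IsSOTClosed
  rw [Set.sInter_eq_biInter, Set.image_iInter₂ hinj]
  exact isClosed_biInter h

section Span

variable {𝕜 : Type*} [Semiring 𝕜] [Module 𝕜 (H →L[ℂ] H)]

lemma isSOTClosed_sotSpan (S : Set (H →L[ℂ] H)) : IsSOTClosed (sotSpan 𝕜 S : Set (H →L[ℂ] H)) := by
  rw [sotSpan, Submodule.coe_sInf, ← Set.sInter_image]
  refine isSOTClosed_sInter ?_
  rintro _ ⟨M, hM, rfl⟩
  exact hM.1

lemma subset_sotSpan (S : Set (H →L[ℂ] H)) : S ⊆ sotSpan 𝕜 S := by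
  intro T hT
  rw [SetLike.mem_coe, sotSpan, Submodule.mem_sInf]
  exact fun M hM => hM.2 hT

lemma sotSpan_le {S : Set (H →L[ℂ] H)} {M : Submodule 𝕜 (H →L[ℂ] H)}
    (hM : IsSOTClosed (M : Set (H →L[ℂ] H))) (h : S ⊆ M) : sotSpan 𝕜 S ≤ M :=
  sInf_le ⟨hM, h⟩

end Span

variable [CompleteSpace H]

/-- The filter is arbitrary, so Banach–Steinhaus is not available; the uniform bound `C` makes the
limit continuous. -/
lemma exists_pointwise_limit {ι : Type*} {l : Filter ι} [l.NeBot] {T : ι → H →L[ℂ] H} {C : ℝ}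
    (hC : ∀ i, ‖T i‖ ≤ C) (hT : ∀ x, Cauchy (map (fun i => T i x) l)) :
    ∃ A : H →L[ℂ] H, ∀ x, Tendsto (fun i => T i x) l (𝓝 (A x)) := by
  choose A hA using fun x => CompleteSpace.complete (hT x)
  change ∀ x, Tendsto (fun i => T i x) l (𝓝 (A x)) at hA
  have hA' : Tendsto (fun i x => T i x) l (𝓝 A) := tendsto_pi_nhds.2 hA
  let A' : H →ₗ[ℂ] H := linearMapOfTendsto A (fun i => (T i : H →ₗ[ℂ] H)) hA'
  refine ⟨A'.mkContinuous C fun x => ?_, hA⟩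
  refine le_of_tendsto (hA x).norm (Eventually.of_forall fun i => ?_)
  exact (T i).le_of_opNorm_le (hC i) x

lemma isSelfAdjoint_of_tendsto {ι : Type*} {l : Filter ι} [l.NeBot] {T : ι → H →L[ℂ] H}
    {A : H →L[ℂ] H} (hT : ∀ i, IsSelfAdjoint (T i))
    (h : ∀ x, Tendsto (fun i => T i x) l (𝓝 (A x))) : IsSelfAdjoint A := by
  rw [ContinuousLinearMap.isSelfAdjoint_iff_isSymmetric]
  intro x y
  refine tendsto_nhds_unique ((h x).inner tendsto_const_nhds)
    ((tendsto_const_nhds.inner (h y)).congr fun i => ?_)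
  exact ((hT i).isSymmetric x y).symm

variable {L : Submodule ℂ (H →L[ℂ] H)}

lemma exists_saPart_limit (hL : IsSOTClosed (L : Set (H →L[ℂ] H))) {ι : Type*} {l : Filter ι}
    [l.NeBot] {T : ι → saPart L} {C : ℝ} (hC : ∀ i, ‖(T i : H →L[ℂ] H)‖ ≤ C)
    (hT : ∀ x, Cauchy (map (fun i => (T i : H →L[ℂ] H) x) l)) :
    ∃ A : saPart L, ∀ x, Tendsto (fun i => (T i : H →L[ℂ] H) x) l (𝓝 ((A : H →L[ℂ] H) x)) := by
  obtain ⟨A, hA⟩ := exists_pointwise_limit hC hT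
  exact ⟨⟨A, hL.mem_of_tendsto (fun i => (T i).2.1) hA,
    isSelfAdjoint_of_tendsto (fun i => isSelfAdjoint_of_saPart (T i)) hA⟩, hA⟩

/-- `norm_apply_sq_le` for `T - S`, whose norm is replaced by that of a common bound `B`, so that
the constant is uniform along a net. -/
lemma saPart_norm_apply_sub_sq_le {S T B : saPart L} (h1 : S ≤ T) (h2 : T - S ≤ B) (x : H) :
    ‖(T : H →L[ℂ] H) x - (S : H →L[ℂ] H) x‖ ^ 2 ≤
      ‖(B : H →L[ℂ] H)‖ * (quadForm (T : H →L[ℂ] H) x - quadForm (S : H →L[ℂ] H) x) := by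
  have h3 : (0 : H →L[ℂ] H) ≤ (T : H →L[ℂ] H) - S := sub_nonneg.2 h1
  have h4 := norm_apply_sq_le h3 x
  rw [quadForm_sub, sub_apply] at h4
  refine h4.trans (mul_le_mul_of_nonneg_right ?_ ?_)
  · exact CStarAlgebra.norm_le_norm_of_nonneg_of_le h3 h2
  · rw [← quadForm_sub]; exact quadForm_nonneg h3 x

/-- A bounded increasing sequence of self-adjoint operators converges strongly. -/
lemma exists_limit_of_monotone (hL : IsSOTClosed (L : Set (H →L[ℂ] H))) {T : ℕ → saPart L}
    (hT : Monotone T) {B : saPart L} (hB : ∀ n, T n ≤ B) :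
    ∃ A : saPart L, ∀ x,
      Tendsto (fun n => (T n : H →L[ℂ] H) x) atTop (𝓝 ((A : H →L[ℂ] H) x)) := by
  -- All increments have the common bound `B - T 0`.
  have hd : ∀ m n, m ≤ n → T n - T m ≤ B - T 0 := fun m n _ =>
    sub_le_sub (hB n) (hT (Nat.zero_le m))
  set M := ‖((B - T 0 : saPart L) : H →L[ℂ] H)‖
  refine exists_saPart_limit hL (C := ‖(T 0 : H →L[ℂ] H)‖ + M) (fun n => ?_) fun x => ?_
  · have : ‖(T n : H →L[ℂ] H) - T 0‖ ≤ M :=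
      CStarAlgebra.norm_le_norm_of_nonneg_of_le (sub_nonneg.2 (hT (Nat.zero_le n)))
        (hd 0 n (Nat.zero_le n))
    calc ‖(T n : H →L[ℂ] H)‖ = ‖(T 0 : H →L[ℂ] H) + ((T n : H →L[ℂ] H) - T 0)‖ := by
          rw [add_sub_cancel]
      _ ≤ _ := (norm_add_le _ _).trans (by gcongr)
  · have hmono : Monotone fun n => quadForm (T n : H →L[ℂ] H) x :=
      fun m n hmn => saPart_le_iff.1 (hT hmn) x
    have hbdd : BddAbove (Set.range fun n => quadForm (T n : H →L[ℂ] H) x) :=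
      ⟨quadForm (B : H →L[ℂ] H) x, by rintro _ ⟨n, rfl⟩; exact saPart_le_iff.1 (hB n) x⟩
    have hc := (tendsto_atTop_ciSup hmono hbdd).cauchySeq
    rw [Metric.cauchySeq_iff'] at hc
    refine Metric.cauchySeq_iff'.2 fun ε hε => ?_
    -- The forms are Cauchy, and `‖T n x - T N x‖²` is at most `M` times their increment; `M + 1`
    -- avoids dividing by zero.
    obtain ⟨N, hN⟩ := hc (ε ^ 2 / (M + 1)) (by positivity)
    refine ⟨N, fun n hn => ?_⟩
    have h1 := saPart_norm_apply_sub_sq_le (hT hn) (hd N n hn) x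
    have h2 := hN n hn
    rw [Real.dist_eq] at h2
    have h3 := (le_abs_self _).trans_lt h2
    rw [lt_div_iff₀ (by positivity)] at h3
    have h4 : 0 ≤ quadForm (T n : H →L[ℂ] H) x - quadForm (T N : H →L[ℂ] H) x :=
      sub_nonneg.2 (hmono hn)
    rw [dist_eq_norm]
    refine lt_of_pow_lt_pow_left₀ 2 hε.le ?_
    change _ ≤ M * _ at h1
    nlinarith

end SOT

/-! ### Measures and order integrals with values in an ordered vector space -/

namespace PosMeasure

/-! ### Finite additivity and continuity from below -/

section Additivity

variable {X : Type*} [MeasurableSpace X] {E : Type*} [AddCommGroup E] [PartialOrder E]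

lemma ext_of_measurableSet {μ ν : PosMeasure X E} (h : ∀ Δ, MeasurableSet Δ → μ Δ = ν Δ) :
    μ = ν := by
  have : μ.toFun = ν.toFun := by
    funext Δ
    by_cases hΔ : MeasurableSet Δ
    · exact h Δ hΔ
    · rw [μ.not_measurable' Δ hΔ, ν.not_measurable' Δ hΔ]
  cases μ; cases ν; simpa using this

variable [IsOrderedAddMonoid E] (ν : PosMeasure X E)

/-- Pad the family with empty sets: the increasing partial sums are constant from `N` on, so their
supremum is the finite sum. -/
lemma measure_biUnion_range {A : ℕ → Set X} (hA : ∀ n, MeasurableSet (A n))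
    (hd : Pairwise (Function.onFun Disjoint A)) (N : ℕ) :
    ν (⋃ n ∈ Finset.range N, A n) = ∑ n ∈ Finset.range N, ν (A n) := by
  classical
  let B : ℕ → Set X := fun n => if n < N then A n else ∅
  have hB : ∀ n, MeasurableSet (B n) := fun n => by
    by_cases h : n < N <;> simp [B, h, hA]
  have hBd : Pairwise (Function.onFun Disjoint B) := fun i j hij => by
    by_cases hi : i < N <;> by_cases hj : j < N <;> simp [B, hi, hj, Function.onFun]
    exact hd hij
  have hU : (⋃ n, B n) = ⋃ n ∈ Finset.range N, A n := by
    ext x; simp only [B, Set.mem_iUnion, Finset.mem_range, exists_prop]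
    refine exists_congr fun n => ?_
    by_cases h : n < N <;> simp [h]
  have hlub := ν.isLUB_iUnion' B hB hBd
  rw [hU] at hlub
  have hsum : ∑ n ∈ Finset.range N, ν (B n) = ∑ n ∈ Finset.range N, ν (A n) :=
    Finset.sum_congr rfl fun n hn => by simp [B, Finset.mem_range.1 hn]
  refine hlub.unique ⟨?_, fun b hb => ?_⟩
  · rintro _ ⟨M, rfl⟩
    have hz : ∀ n, n ∉ Finset.range N → ν (B n) = 0 := fun n hn => by
      have : ¬ n < N := by simpa using hn
      simp [B, this, ν.empty']
    change ∑ n ∈ Finset.range M, ν (B n) ≤ _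
    calc ∑ n ∈ Finset.range M, ν (B n) ≤ ∑ n ∈ Finset.range M ∪ Finset.range N, ν (B n) :=
          Finset.sum_le_sum_of_subset_of_nonneg Finset.subset_union_left
            fun _ _ _ => ν.nonneg' _
      _ = ∑ n ∈ Finset.range N, ν (B n) :=
          (Finset.sum_subset Finset.subset_union_right fun n _ hn => hz n hn).symm
      _ = _ := hsum
  · rw [← hsum]; exact hb ⟨N, rfl⟩

lemma measure_union {A B : Set X} (hA : MeasurableSet A) (hB : MeasurableSet B)
    (h : Disjoint A B) : ν (A ∪ B) = ν A + ν B := by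
  let D : ℕ → Set X := fun n => if n = 0 then A else if n = 1 then B else ∅
  have hD : ∀ n, MeasurableSet (D n) := fun n => by
    by_cases h0 : n = 0 <;> by_cases h1 : n = 1 <;> simp [D, h0, h1, hA, hB]
  have hd : Pairwise (Function.onFun Disjoint D) := fun i j hij => by
    by_cases hi : i = 0 <;> by_cases hi1 : i = 1 <;> by_cases hj : j = 0 <;>
      by_cases hj1 : j = 1 <;> simp_all [D, Function.onFun]
    exact h.symm
  have := ν.measure_biUnion_range hD hd 2
  rw [Finset.sum_range_succ, Finset.sum_range_one] at this
  simpa [D, Finset.range_add_one, Set.union_comm] using this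

lemma measure_mono {A B : Set X} (hA : MeasurableSet A) (hB : MeasurableSet B) (h : A ⊆ B) :
    ν A ≤ ν B := by
  rw [← Set.union_sdiff_cancel h, ν.measure_union hA (hB.diff hA) Set.disjoint_sdiff_right]
  exact le_add_of_nonneg_right (ν.nonneg' _)

lemma measure_biUnion_finset {ι : Type*} (s : Finset ι) {A : ι → Set X}
    (hA : ∀ i ∈ s, MeasurableSet (A i)) (hd : (s : Set ι).PairwiseDisjoint A) :
    ν (⋃ i ∈ s, A i) = ∑ i ∈ s, ν (A i) := by
  classical
  induction s using Finset.induction_on with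
  | empty => simpa using ν.empty'
  | insert a s ha ih =>
    rw [Finset.set_biUnion_insert, Finset.sum_insert ha, ν.measure_union, ih]
    · exact fun i hi => hA i (Finset.mem_insert_of_mem hi)
    · exact hd.subset (by simp)
    · exact hA a (Finset.mem_insert_self _ _)
    · exact Finset.measurableSet_biUnion s fun i hi => hA i (Finset.mem_insert_of_mem hi)
    · simp only [Set.disjoint_iUnion_right]
      exact fun i hi => hd (by simp) (by simp [hi]) (by rintro rfl; exact ha hi)

/-- The partial sums over the disjointed sequence are measures of finite unions, each contained in
some `A N`. -/
lemma isLUB_iUnion_of_monotone {A : ℕ → Set X} (hA : ∀ n, MeasurableSet (A n))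
    (hmono : Monotone A) : IsLUB (Set.range fun n => ν (A n)) (ν (⋃ n, A n)) := by
  have hlub := ν.isLUB_iUnion' (disjointed A) (MeasurableSet.disjointed hA)
    (disjoint_disjointed A)
  rw [iUnion_disjointed] at hlub
  refine ⟨?_, fun b hb => hlub.2 ?_⟩
  · rintro _ ⟨n, rfl⟩
    exact ν.measure_mono (hA n) (MeasurableSet.iUnion hA) (Set.subset_iUnion A n)
  · rintro _ ⟨N, rfl⟩
    change ∑ n ∈ Finset.range N, ν (disjointed A n) ≤ b
    rw [← ν.measure_biUnion_range (MeasurableSet.disjointed hA) (disjoint_disjointed A)]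
    refine le_trans (ν.measure_mono (Finset.measurableSet_biUnion _ fun n _ =>
      MeasurableSet.disjointed hA n) (hA N) ?_) (hb ⟨N, rfl⟩)
    refine Set.iUnion₂_subset fun n hn => (disjointed_le A n).trans ?_
    exact hmono (Finset.mem_range.1 hn).le

lemma sum_measure_preimage_le (φ : SimpleFunc X ℝ≥0) {s : Finset ℝ≥0} {A : Set X}
    (hA : MeasurableSet A) (h : ∀ x, φ x ∈ s → x ∈ A) :
    ∑ r ∈ s, ν (φ ⁻¹' {r}) ≤ ν A := by
  rw [← ν.measure_biUnion_finset s (fun r _ => φ.measurableSet_preimage _)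
    ((Set.pairwiseDisjoint_fiber φ _))]
  refine ν.measure_mono (Finset.measurableSet_biUnion _ fun r _ => φ.measurableSet_preimage _)
    hA ?_
  intro x hx
  simp only [Set.mem_iUnion, Set.mem_preimage, Set.mem_singleton_iff, exists_prop,
    exists_eq_right'] at hx
  exact h x hx

lemma le_sum_measure_preimage (φ : SimpleFunc X ℝ≥0) {s : Finset ℝ≥0} {A : Set X}
    (hA : MeasurableSet A) (h : ∀ x ∈ A, φ x ∈ s) :
    ν A ≤ ∑ r ∈ s, ν (φ ⁻¹' {r}) := by
  rw [← ν.measure_biUnion_finset s (fun r _ => φ.measurableSet_preimage _)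
    ((Set.pairwiseDisjoint_fiber φ _))]
  refine ν.measure_mono hA
    (Finset.measurableSet_biUnion _ fun r _ => φ.measurableSet_preimage _) ?_
  intro x hx
  simp only [Set.mem_iUnion, Set.mem_preimage, Set.mem_singleton_iff, exists_prop,
    exists_eq_right']
  exact h x hx

end Additivity

/-! ### Nonnegative multiples in the extended space -/

section ExtSMul

variable {E : Type*} [AddCommGroup E] [Module ℝ E]

@[simp] lemma extSMul_zero_left (a : WithTop E) : extSMul 0 a = 0 := by
  cases a <;> simp [extSMul]

@[simp] lemma extSMul_coe (r : ℝ≥0) (a : E) :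
    extSMul r (a : WithTop E) = (((r : ℝ) • a : E) : WithTop E) := rfl

lemma extSMul_top {r : ℝ≥0} (hr : r ≠ 0) : extSMul r (⊤ : WithTop E) = ⊤ := by
  simp [extSMul, hr]

@[simp] lemma extSMul_one (a : WithTop E) : extSMul 1 a = a := by
  cases a <;> simp [extSMul]

@[simp] lemma extSMul_zero_right (r : ℝ≥0) : extSMul r (0 : WithTop E) = 0 := by
  rw [← WithTop.coe_zero, extSMul_coe, smul_zero]

lemma extSMul_add (r : ℝ≥0) (a b : WithTop E) :
    extSMul r (a + b) = extSMul r a + extSMul r b := by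
  rcases eq_or_ne r 0 with rfl | hr
  · simp
  cases a with
  | top => rw [WithTop.top_add, extSMul_top hr, WithTop.top_add]
  | coe a =>
    cases b with
    | top => rw [WithTop.add_top, extSMul_top hr, WithTop.add_top]
    | coe b =>
      rw [← WithTop.coe_add, extSMul_coe, extSMul_coe, extSMul_coe, smul_add, WithTop.coe_add]

lemma extSMul_sum {ι : Type*} (r : ℝ≥0) (s : Finset ι) (a : ι → WithTop E) :
    extSMul r (∑ i ∈ s, a i) = ∑ i ∈ s, extSMul r (a i) := by
  classical
  induction s using Finset.induction_on with
  | empty => simp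
  | insert i s hi ih => rw [Finset.sum_insert hi, Finset.sum_insert hi, extSMul_add, ih]

variable [PartialOrder E] [PosSMulMono ℝ E]

lemma extSMul_mono_right (r : ℝ≥0) {a b : WithTop E} (h : a ≤ b) :
    extSMul r a ≤ extSMul r b := by
  rcases eq_or_ne r 0 with rfl | hr
  · simp
  cases b with
  | top => rw [extSMul_top hr]; exact le_top
  | coe b =>
    lift a to E using ne_top_of_le_ne_top WithTop.coe_ne_top h
    rw [extSMul_coe, extSMul_coe, WithTop.coe_le_coe]
    exact smul_le_smul_of_nonneg_left (WithTop.coe_le_coe.1 h) r.2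

lemma extSMul_nonneg (r : ℝ≥0) {a : WithTop E} (h : 0 ≤ a) : 0 ≤ extSMul r a := by
  simpa using extSMul_mono_right r h

end ExtSMul

/-! ### Order integrals of general, possibly infinite, measures -/

section Integral

variable {X : Type*} [MeasurableSpace X] {E : Type*} [AddCommGroup E] [PartialOrder E]
  [Module ℝ E]

variable (ν : PosMeasure X E)

lemma elemIntegral_eq_zero {φ : SimpleFunc X ℝ≥0} (h : ∀ x, φ x = 0) : ν.elemIntegral φ = 0 := by
  refine Finset.sum_eq_zero fun r hr => ?_
  obtain ⟨x, rfl⟩ := SimpleFunc.mem_range.1 hr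
  rw [h x, extSMul_zero_left]

/-- The integral is a chosen value, so every admissible value has to be shown to vanish. It disposes
of the negative part of a positive function. -/
lemma orderIntegral_zero : ν.orderIntegral (fun _ => 0) = 0 := by
  have h0 : ∀ I, ν.IsOrderIntegral (fun _ => 0) I → I = 0 := by
    rintro I ⟨φ, -, hφ, hI⟩
    have hz : ∀ n, ν.elemIntegral (φ n) = 0 := fun n => ν.elemIntegral_eq_zero fun x => by
      have h1 : (φ n x : ℝ≥0∞) ≤ 0 :=
        (le_iSup (fun n => (φ n x : ℝ≥0∞)) n).trans (hφ x).le
      simpa using h1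
    simp only [hz, Set.range_const] at hI
    exact hI.unique isLUB_singleton
  have hex : ∃ I, ν.IsOrderIntegral (fun _ => 0) I := by
    refine ⟨0, fun _ => 0, monotone_const, by simp, ?_⟩
    simp only [ν.elemIntegral_eq_zero (φ := 0) (fun _ => rfl), Set.range_const]
    exact isLUB_singleton
  rw [orderIntegral, dif_pos hex]
  exact h0 _ hex.choose_spec

/-- The default value is `⊤`, so a finite value must come from a genuine supremum. -/
lemma isOrderIntegral_of_ne_top {f : X → ℝ≥0∞} (h : ν.orderIntegral f ≠ ⊤) :
    ν.IsOrderIntegral f (ν.orderIntegral f) := by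
  by_cases hex : ∃ I, ν.IsOrderIntegral f I
  · rw [orderIntegral, dif_pos hex]; exact hex.choose_spec
  · rw [orderIntegral, dif_neg hex] at h; exact absurd rfl h

lemma orderIntegral_eq_of_forall {f : X → ℝ≥0∞} {I : WithTop E} (hex : ν.IsOrderIntegral f I)
    (h : ∀ J, ν.IsOrderIntegral f J → J = I) : ν.orderIntegral f = I := by
  rw [orderIntegral, dif_pos ⟨I, hex⟩]
  exact h _ (Exists.choose_spec ⟨I, hex⟩)

lemma integral_of_nonneg {f : X → ℝ} (hf : ∀ x, 0 ≤ f x) :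
    ν.integral f = (ν.orderIntegral fun x => ENNReal.ofReal (f x)).untopD 0 := by
  have : (fun x => ENNReal.ofReal (-f x)) = fun _ => 0 := by
    funext x; exact ENNReal.ofReal_of_nonpos (neg_nonpos.2 (hf x))
  rw [integral, this, orderIntegral_zero]
  simp [← WithTop.coe_zero]

variable [IsOrderedAddMonoid E] [PosSMulMono ℝ E]

lemma extSMul_mono_left {r s : ℝ≥0} (hrs : r ≤ s) {a : WithTop E} (h : 0 ≤ a) :
    extSMul r a ≤ extSMul s a := by
  rcases eq_or_ne r 0 with rfl | hr
  · simpa using extSMul_nonneg s h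
  have hs : s ≠ 0 := (lt_of_lt_of_le (pos_iff_ne_zero.2 hr) hrs).ne'
  cases a with
  | top => rw [extSMul_top hr, extSMul_top hs]
  | coe a =>
    rw [extSMul_coe, extSMul_coe, WithTop.coe_le_coe, ← sub_nonneg, ← sub_smul]
    exact smul_nonneg (sub_nonneg.2 hrs) (WithTop.coe_nonneg.1 h)

lemma elemIntegral_le {φ : SimpleFunc X ℝ≥0} {A : Set X} (hA : MeasurableSet A)
    (h1 : ∀ x, φ x ≤ 1) (h0 : ∀ x, x ∉ A → φ x = 0) : ν.elemIntegral φ ≤ ν A := by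
  classical
  calc ν.elemIntegral φ = ∑ r ∈ φ.range.filter (· ≠ 0), extSMul r (ν (φ ⁻¹' {r})) := by
        -- The level `0` contributes nothing, whereas its fibre need not lie in `A`.
        refine (Finset.sum_filter_of_ne fun r _ hr => ?_).symm
        rintro rfl
        exact hr (extSMul_zero_left _)
    _ ≤ ∑ r ∈ φ.range.filter (· ≠ 0), ν (φ ⁻¹' {r}) := by
        refine Finset.sum_le_sum fun r hr => ?_
        obtain ⟨x, rfl⟩ := SimpleFunc.mem_range.1 (Finset.mem_filter.1 hr).1
        simpa using extSMul_mono_left (h1 x) (ν.nonneg' (φ ⁻¹' {φ x}))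
    _ ≤ ν A := by
        refine ν.sum_measure_preimage_le φ hA fun x hx => ?_
        by_contra hxA
        exact (Finset.mem_filter.1 hx).2 (h0 x hxA)

/-- Markov's inequality: keep only the levels `r ≥ c`, whose fibres cover `A`, and lower each
coefficient to `c`. -/
lemma extSMul_le_elemIntegral {φ : SimpleFunc X ℝ≥0} {A : Set X} (hA : MeasurableSet A)
    {c : ℝ≥0} (h : ∀ x ∈ A, c ≤ φ x) : extSMul c (ν A) ≤ ν.elemIntegral φ := by
  classical
  calc extSMul c (ν A) ≤ extSMul c (∑ r ∈ φ.range.filter (c ≤ ·), ν (φ ⁻¹' {r})) := by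
        refine extSMul_mono_right c (ν.le_sum_measure_preimage φ hA fun x hx => ?_)
        exact Finset.mem_filter.2 ⟨φ.mem_range_self x, h x hx⟩
    _ = ∑ r ∈ φ.range.filter (c ≤ ·), extSMul c (ν (φ ⁻¹' {r})) := extSMul_sum _ _ _
    _ ≤ ∑ r ∈ φ.range.filter (c ≤ ·), extSMul r (ν (φ ⁻¹' {r})) :=
        Finset.sum_le_sum fun r hr =>
          extSMul_mono_left (Finset.mem_filter.1 hr).2 (ν.nonneg' _)
    _ ≤ ν.elemIntegral φ :=
        Finset.sum_le_sum_of_subset_of_nonneg (Finset.filter_subset _ _)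
          fun r _ _ => extSMul_nonneg r (ν.nonneg' _)

lemma orderIntegral_le_measure {f : X → ℝ≥0∞} {i : E} (hi : ν.orderIntegral f = i) {A : Set X}
    (hA : MeasurableSet A) (h1 : ∀ x, f x ≤ 1) (h0 : ∀ x, x ∉ A → f x = 0) :
    (i : WithTop E) ≤ ν A := by
  obtain ⟨φ, -, hφ, hlub⟩ := ν.isOrderIntegral_of_ne_top (hi ▸ WithTop.coe_ne_top)
  rw [hi] at hlub
  have hle : ∀ n x, (φ n x : ℝ≥0∞) ≤ f x := fun n x =>
    hφ x ▸ le_iSup (fun n => (φ n x : ℝ≥0∞)) n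
  refine hlub.2 ?_
  rintro _ ⟨n, rfl⟩
  refine ν.elemIntegral_le hA (fun x => ?_) fun x hx => ?_
  · exact_mod_cast (hle n x).trans (h1 x)
  · have := hle n x
    rw [h0 x hx] at this
    simpa using this

/-- Approximating elementary functions need not reach `1` on `A`, so a factor `c < 1` is given away.
The sets `A ∩ {φ n ≥ c}` increase to `A`, Markov's inequality bounds their measures, and continuity
from below concludes. -/
lemma measure_le_smul_orderIntegral {f : X → ℝ≥0∞} {i : E} (hi : ν.orderIntegral f = i)
    {A : Set X} (hA : MeasurableSet A) (h1 : ∀ x ∈ A, 1 ≤ f x) {c : ℝ≥0} (hc0 : c ≠ 0)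
    (hc1 : c < 1) : ν A ≤ (((c⁻¹ : ℝ) • i : E) : WithTop E) := by
  obtain ⟨φ, hmono, hφ, hlub⟩ := ν.isOrderIntegral_of_ne_top (hi ▸ WithTop.coe_ne_top)
  rw [hi] at hlub
  let B : ℕ → Set X := fun n => A ∩ φ n ⁻¹' Set.Ici c
  have hB : ∀ n, MeasurableSet (B n) := fun n => hA.inter ((φ n).measurableSet_preimage _)
  have hBm : Monotone B := fun m n hmn x hx => ⟨hx.1, le_trans hx.2 (hmono hmn x)⟩
  have hBU : (⋃ n, B n) = A := by
    refine subset_antisymm (Set.iUnion_subset fun n => Set.inter_subset_left) fun x hx => ?_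
    have : (c : ℝ≥0∞) < ⨆ n, (φ n x : ℝ≥0∞) := by
      rw [hφ x]; exact lt_of_lt_of_le (by exact_mod_cast hc1) (h1 x hx)
    obtain ⟨n, hn⟩ := lt_iSup_iff.1 this
    exact Set.mem_iUnion.2 ⟨n, hx, by exact_mod_cast hn.le⟩
  have hl := ν.isLUB_iUnion_of_monotone hB hBm
  rw [hBU] at hl
  refine hl.2 ?_
  rintro _ ⟨n, rfl⟩
  have h2 : extSMul c (ν (B n)) ≤ i :=
    (ν.extSMul_le_elemIntegral (hB n) fun x hx => hx.2).trans (hlub.1 ⟨n, rfl⟩)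
  -- An infinite measure would force `c • ⊤ = ⊤ ≤ i`, as `c ≠ 0`.
  have h3 : ν (B n) ≠ ⊤ := by
    intro h
    rw [h, extSMul_top hc0] at h2
    exact absurd h2 (by simp)
  change ν (B n) ≤ _
  lift ν (B n) to E using h3 with b
  rw [extSMul_coe, WithTop.coe_le_coe] at h2
  rw [WithTop.coe_le_coe]
  have := smul_le_smul_of_nonneg_left h2 (inv_nonneg.2 c.2 : (0 : ℝ) ≤ (c : ℝ)⁻¹)
  rwa [inv_smul_smul₀ (by exact_mod_cast hc0)] at this

end Integral

end PosMeasure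

/-! ### Suprema and infima of self-adjoint operators -/

section Lattice

variable {H : Type*} [NormedAddCommGroup H] [InnerProductSpace ℂ H] [CompleteSpace H]
  {L : Submodule ℂ (H →L[ℂ] H)}

/-- An upper bound in `saPart L` bounds every form from above, hence bounds the pointwise supremum.
-/
lemma isLUB_of_quadForm {S : Set (saPart L)} {T : saPart L}
    (h : ∀ x, IsLUB ((fun A : saPart L => quadForm (A : H →L[ℂ] H) x) '' S)
      (quadForm (T : H →L[ℂ] H) x)) : IsLUB S T := by
  refine ⟨fun A hA => saPart_le_iff.2 fun x => (h x).1 ⟨A, hA, rfl⟩,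
    fun B hB => saPart_le_iff.2 fun x => (h x).2 ?_⟩
  rintro _ ⟨A, hA, rfl⟩
  exact saPart_le_iff.1 (hB hA) x

lemma isGLB_of_quadForm {S : Set (saPart L)} {T : saPart L}
    (h : ∀ x, IsGLB ((fun A : saPart L => quadForm (A : H →L[ℂ] H) x) '' S)
      (quadForm (T : H →L[ℂ] H) x)) : IsGLB S T := by
  refine ⟨fun A hA => saPart_le_iff.2 fun x => (h x).1 ⟨A, hA, rfl⟩,
    fun B hB => saPart_le_iff.2 fun x => (h x).2 ?_⟩
  rintro _ ⟨A, hA, rfl⟩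
  exact saPart_le_iff.1 (hB hA) x

lemma isLUB_withTop_coe {E : Type*} [PartialOrder E] {S : Set E} {T : E} (h : IsLUB S T) :
    IsLUB ((fun A : E => (A : WithTop E)) '' S) (T : WithTop E) := by
  refine ⟨?_, fun b hb => ?_⟩
  · rintro _ ⟨A, hA, rfl⟩
    exact WithTop.coe_le_coe.2 (h.1 hA)
  · cases b with
    | top => exact le_top
    | coe b => exact WithTop.coe_le_coe.2 (h.2 fun A hA => WithTop.coe_le_coe.1 (hb ⟨A, hA, rfl⟩))

/-- Nonemptiness matters: the infimum of the empty set in `WithTop E` is `⊤`. -/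
lemma isGLB_withTop_coe {E : Type*} [PartialOrder E] {S : Set E} {T : E} (h : IsGLB S T)
    (hS : S.Nonempty) : IsGLB ((fun A : E => (A : WithTop E)) '' S) (T : WithTop E) := by
  refine ⟨?_, fun b hb => ?_⟩
  · rintro _ ⟨A, hA, rfl⟩
    exact WithTop.coe_le_coe.2 (h.1 hA)
  · obtain ⟨A, hA⟩ := hS
    lift b to E using ne_top_of_le_ne_top WithTop.coe_ne_top (hb ⟨A, hA, rfl⟩)
    exact WithTop.coe_le_coe.2 (h.2 fun A hA => WithTop.coe_le_coe.1 (hb ⟨A, hA, rfl⟩))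

end Lattice

/-! ### Finite operator-valued measures and their scalar measures -/

namespace PosMeasure

variable {X : Type*} [MeasurableSpace X]
  {H : Type*} [NormedAddCommGroup H] [InnerProductSpace ℂ H] [CompleteSpace H]
  {L : Submodule ℂ (H →L[ℂ] H)}

lemma hasSum_measureReal_iUnion (ρ : Measure X) [IsFiniteMeasure ρ] {Δ : ℕ → Set X}
    (hΔ : ∀ n, MeasurableSet (Δ n)) (hd : Pairwise (Function.onFun Disjoint Δ)) :
    HasSum (fun n => ρ.real (Δ n)) (ρ.real (⋃ n, Δ n)) := by
  have h1 := measure_iUnion hd hΔ (μ := ρ)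
  have h2 : (∑' n, ρ (Δ n)) ≠ ⊤ := h1 ▸ measure_ne_top _ _
  simp only [measureReal_def, h1]
  rw [ENNReal.tsum_toReal_eq fun n => measure_ne_top _ _]
  exact ENNReal.hasSum_toReal h2

/-- The finite measures `m x` are given by `Δ ↦ ⟨x, μ(Δ) x⟩`, where `μ` is finite. -/
structure HasScalarMeasures (μ : PosMeasure X (saPart L)) (m : H → Measure X) : Prop where
  isFiniteMeasure : ∀ x, IsFiniteMeasure (m x)
  ne_top : ∀ Δ, μ Δ ≠ ⊤
  real_eq : ∀ x Δ, MeasurableSet Δ → (m x).real Δ = quadForm (μ.value Δ : H →L[ℂ] H) x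

/-- The operator-valued measure that is determined by a family of scalar measures. -/
def ofScalarMeasures (m : H → Measure X) (hfin : ∀ x, IsFiniteMeasure (m x))
    (v : Set X → saPart L) (h0 : ∀ Δ, ¬ MeasurableSet Δ → v Δ = 0)
    (hv : ∀ x Δ, MeasurableSet Δ → (m x).real Δ = quadForm (v Δ : H →L[ℂ] H) x) :
    PosMeasure X (saPart L) where
  toFun Δ := (v Δ : WithTop (saPart L))
  not_measurable' Δ hΔ := by rw [h0 Δ hΔ, WithTop.coe_zero]
  nonneg' Δ := by
    rw [WithTop.coe_nonneg]
    by_cases hΔ : MeasurableSet Δ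
    · refine saPart_le_iff.2 fun x => ?_
      rw [← hv x Δ hΔ]
      simp
    · rw [h0 Δ hΔ]
  empty' := by
    rw [WithTop.coe_eq_zero]
    exact saPart_ext_quadForm fun x => by rw [← hv x ∅ .empty]; simp
  isLUB_iUnion' Δ hΔ hd := by
    -- Each form of the partial sums increases to the form of the union, by σ-additivity of `m x`.
    have key : IsLUB (Set.range fun N : ℕ => ∑ n ∈ Finset.range N, v (Δ n)) (v (⋃ n, Δ n)) := by
      refine isLUB_of_quadForm fun x => ?_
      have := hfin x
      rw [← Set.range_comp, ← hv x _ (MeasurableSet.iUnion hΔ)]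
      have hs := hasSum_measureReal_iUnion (m x) hΔ hd
      have he : ((fun A : saPart L => quadForm (A : H →L[ℂ] H) x) ∘
          fun N : ℕ => ∑ n ∈ Finset.range N, v (Δ n)) =
          fun N : ℕ => ∑ n ∈ Finset.range N, (m x).real (Δ n) := by
        funext N
        simp only [Function.comp_apply, Submodule.coe_sum, quadForm_sum]
        exact Finset.sum_congr rfl fun n _ => (hv x _ (hΔ n)).symm
      rw [he]
      refine isLUB_of_tendsto_atTop (fun M N hMN => ?_) hs.tendsto_sum_nat
      exact Finset.sum_le_sum_of_subset_of_nonneg (Finset.range_mono hMN)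
        fun _ _ _ => measureReal_nonneg
    have := isLUB_withTop_coe key
    rw [← Set.range_comp] at this
    simpa [Function.comp_def] using this

lemma hasScalarMeasures_ofScalarMeasures (m : H → Measure X) (hfin : ∀ x, IsFiniteMeasure (m x))
    (v : Set X → saPart L) (h0 : ∀ Δ, ¬ MeasurableSet Δ → v Δ = 0)
    (hv : ∀ x Δ, MeasurableSet Δ → (m x).real Δ = quadForm (v Δ : H →L[ℂ] H) x) :
    (ofScalarMeasures m hfin v h0 hv).HasScalarMeasures m where
  isFiniteMeasure := hfin
  ne_top _ := WithTop.coe_ne_top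
  real_eq := hv

namespace HasScalarMeasures

variable {μ : PosMeasure X (saPart L)} {m : H → Measure X}

lemma coe_value (h : μ.HasScalarMeasures m) (Δ : Set X) :
    (μ.value Δ : WithTop (saPart L)) = μ Δ := by
  obtain ⟨T, hT⟩ := WithTop.ne_top_iff_exists.1 (h.ne_top Δ)
  rw [value, ← hT, WithTop.untopD_coe]

lemma measure_eq (h : μ.HasScalarMeasures m) (x : H) {Δ : Set X} (hΔ : MeasurableSet Δ) :
    m x Δ = ENNReal.ofReal (quadForm (μ.value Δ : H →L[ℂ] H) x) := by
  have := h.isFiniteMeasure x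
  rw [← h.real_eq x Δ hΔ, ofReal_measureReal]

lemma value_nonneg (h : μ.HasScalarMeasures m) (Δ : Set X) : 0 ≤ μ.value Δ := by
  rw [← WithTop.coe_nonneg, h.coe_value]; exact μ.nonneg' Δ

variable (μ) in
/-- The order integral of an elementary function with respect to a finite measure. -/
def elemValue (φ : SimpleFunc X ℝ≥0) : saPart L :=
  ∑ r ∈ φ.range, (r : ℝ) • μ.value (φ ⁻¹' {r})

lemma elemIntegral_eq (h : μ.HasScalarMeasures m) (φ : SimpleFunc X ℝ≥0) :
    μ.elemIntegral φ = (elemValue μ φ : WithTop (saPart L)) := by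
  rw [elemIntegral, elemValue, WithTop.coe_sum]
  refine Finset.sum_congr rfl fun r _ => ?_
  rw [← h.coe_value, extSMul_coe]

lemma elemValue_nonneg (h : μ.HasScalarMeasures m) (φ : SimpleFunc X ℝ≥0) :
    0 ≤ elemValue μ φ :=
  Finset.sum_nonneg fun r _ => smul_nonneg r.2 (h.value_nonneg _)

lemma quadForm_nonneg_of_nonneg {T : saPart L} (hT : 0 ≤ T) (x : H) :
    0 ≤ quadForm (T : H →L[ℂ] H) x := by
  simpa using saPart_le_iff.1 hT x

lemma lintegral_elem (h : μ.HasScalarMeasures m) (φ : SimpleFunc X ℝ≥0) (x : H) :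
    ∫⁻ y, (φ y : ℝ≥0∞) ∂(m x) = ENNReal.ofReal (quadForm (elemValue μ φ : H →L[ℂ] H) x) := by
  have h1 : ∫⁻ y, (φ y : ℝ≥0∞) ∂(m x) =
      ∑ r ∈ φ.range, (r : ℝ≥0∞) * m x (φ ⁻¹' {r}) := by
    rw [← SimpleFunc.map_lintegral, ← SimpleFunc.lintegral_eq_lintegral]
    rfl
  rw [h1, elemValue, Submodule.coe_sum, quadForm_sum, ENNReal.ofReal_sum_of_nonneg]
  · refine Finset.sum_congr rfl fun r _ => ?_
    rw [Submodule.coe_smul, quadForm_smul, ENNReal.ofReal_mul (NNReal.coe_nonneg r),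
      h.measure_eq x (φ.measurableSet_preimage _), ENNReal.ofReal_coe_nnreal]
  · intro r _
    rw [Submodule.coe_smul, quadForm_smul]
    exact mul_nonneg r.2 (quadForm_nonneg_of_nonneg (h.value_nonneg _) x)

/-- Comparing scalar integrals for every `x` compares the operators. In particular monotonicity
needs no common refinement of partitions. -/
lemma elemValue_le (h : μ.HasScalarMeasures m) {φ : SimpleFunc X ℝ≥0} {f : X → ℝ≥0∞}
    (hφ : ∀ y, (φ y : ℝ≥0∞) ≤ f y) {S : saPart L} (hS : 0 ≤ S)
    (hf : ∀ x, ∫⁻ y, f y ∂(m x) ≤ ENNReal.ofReal (quadForm (S : H →L[ℂ] H) x)) :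
    elemValue μ φ ≤ S := by
  refine saPart_le_iff.2 fun x => ?_
  rw [← ENNReal.ofReal_le_ofReal_iff (quadForm_nonneg_of_nonneg hS x), ← h.lintegral_elem]
  exact (lintegral_mono hφ).trans (hf x)

lemma elemValue_mono (h : μ.HasScalarMeasures m) : Monotone (elemValue μ) := fun φ ψ hφψ =>
  h.elemValue_le (f := fun y => ψ y) (fun y => by exact_mod_cast hφψ y) (h.elemValue_nonneg ψ)
    fun x => (h.lintegral_elem ψ x).le

/-- The elementary integrals increase below `S`, so they converge strongly. The limit is their order
supremum, and monotone convergence for `m x` identifies its form. -/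
lemma exists_limit (h : μ.HasScalarMeasures m) (hL : IsSOTClosed (L : Set (H →L[ℂ] H)))
    {f : X → ℝ≥0∞} {φ : ℕ → SimpleFunc X ℝ≥0} (hmono : Monotone φ)
    (hφ : ∀ y, ⨆ n, (φ n y : ℝ≥0∞) = f y) {S : saPart L} (hS : ∀ n, elemValue μ (φ n) ≤ S) :
    ∃ A : saPart L, IsLUB (Set.range fun n => μ.elemIntegral (φ n)) A ∧ 0 ≤ A ∧
      (∀ x, ∫⁻ y, f y ∂(m x) = ENNReal.ofReal (quadForm (A : H →L[ℂ] H) x)) ∧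
      ∀ x, Tendsto (fun n => (elemValue μ (φ n) : H →L[ℂ] H) x) atTop
        (𝓝 ((A : H →L[ℂ] H) x)) := by
  have hm : Monotone fun n => elemValue μ (φ n) := h.elemValue_mono.comp hmono
  obtain ⟨A, hA⟩ := exists_limit_of_monotone hL hm hS
  have hlub : IsLUB (Set.range fun n => elemValue μ (φ n)) A := by
    refine isLUB_of_quadForm fun x => ?_
    rw [← Set.range_comp]
    exact isLUB_of_tendsto_atTop (fun i j hij => saPart_le_iff.1 (hm hij) x)
      (tendsto_quadForm (hA x))
  refine ⟨A, ?_, (h.elemValue_nonneg (φ 0)).trans (hlub.1 ⟨0, rfl⟩), fun x => ?_, hA⟩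
  · have := isLUB_withTop_coe hlub
    rw [← Set.range_comp] at this
    simpa only [Function.comp_def, ← h.elemIntegral_eq] using this
  · have h1 : Tendsto (fun n => ∫⁻ y, (φ n y : ℝ≥0∞) ∂(m x)) atTop (𝓝 (∫⁻ y, f y ∂(m x))) := by
      simp_rw [← hφ]
      rw [lintegral_iSup (fun n => (φ n).measurable.coe_nnreal_ennreal)
        (fun i j hij y => ENNReal.coe_le_coe.2 (hmono hij y))]
      exact tendsto_atTop_iSup fun i j hij =>
        lintegral_mono fun y => ENNReal.coe_le_coe.2 (hmono hij y)
    simp_rw [h.lintegral_elem] at h1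
    exact tendsto_nhds_unique h1 (ENNReal.tendsto_ofReal (tendsto_quadForm (hA x)))

/-- A finite order integral is the strong limit of the order integrals of elementary functions. -/
lemma of_orderIntegral_eq_coe (h : μ.HasScalarMeasures m)
    (hL : IsSOTClosed (L : Set (H →L[ℂ] H))) {f : X → ℝ≥0∞} {T : saPart L}
    (hT : μ.orderIntegral f = T) :
    0 ≤ T ∧ (∀ x, ∫⁻ y, f y ∂(m x) = ENNReal.ofReal (quadForm (T : H →L[ℂ] H) x)) ∧
      ∃ φ : ℕ → SimpleFunc X ℝ≥0, ∀ x,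
        Tendsto (fun n => (elemValue μ (φ n) : H →L[ℂ] H) x) atTop (𝓝 ((T : H →L[ℂ] H) x)) := by
  obtain ⟨φ, hmono, hφ, hlub⟩ := μ.isOrderIntegral_of_ne_top (hT ▸ WithTop.coe_ne_top)
  rw [hT] at hlub
  obtain ⟨A, hA, hA0, hAi, hAt⟩ := h.exists_limit hL hmono hφ (S := T) fun n => by
    rw [← WithTop.coe_le_coe, ← h.elemIntegral_eq]; exact hlub.1 ⟨n, rfl⟩
  obtain rfl : A = T := WithTop.coe_injective (hA.unique hlub)
  exact ⟨hA0, hAi, φ, hAt⟩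

/-- Domination by `S` makes the supremum exist in `saPart L`. It is independent of the approximating
sequence, because its form is the scalar integral of `f`. -/
lemma exists_orderIntegral_eq_coe (h : μ.HasScalarMeasures m)
    (hL : IsSOTClosed (L : Set (H →L[ℂ] H))) {f : X → ℝ≥0∞} (hf : Measurable f) {S : saPart L}
    (hS0 : 0 ≤ S) (hS : ∀ x, ∫⁻ y, f y ∂(m x) ≤ ENNReal.ofReal (quadForm (S : H →L[ℂ] H) x)) :
    ∃ T : saPart L, μ.orderIntegral f = T := by
  have hle : ∀ {φ : ℕ → SimpleFunc X ℝ≥0}, (∀ y, ⨆ n, (φ n y : ℝ≥0∞) = f y) →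
      ∀ n, elemValue μ (φ n) ≤ S := fun {φ} hφ n =>
    h.elemValue_le (fun y => hφ y ▸ le_iSup (fun n => (φ n y : ℝ≥0∞)) n) hS0 hS
  -- The standard approximants take finite values even where `f` is infinite, so nothing is lost by
  -- `toNNReal`.
  let φ : ℕ → SimpleFunc X ℝ≥0 := fun n => (SimpleFunc.eapprox f n).map ENNReal.toNNReal
  have hc : ∀ n y, ((φ n y : ℝ≥0) : ℝ≥0∞) = SimpleFunc.eapprox f n y := fun n y =>
    ENNReal.coe_toNNReal (SimpleFunc.eapprox_lt_top f n y).ne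
  have hmono : Monotone φ := fun i j hij y => by
    rw [← ENNReal.coe_le_coe, hc, hc]
    exact SimpleFunc.monotone_eapprox f hij y
  have hφ : ∀ y, ⨆ n, (φ n y : ℝ≥0∞) = f y := fun y => by
    simp_rw [hc]; exact SimpleFunc.iSup_eapprox_apply hf y
  obtain ⟨A, hA, hA0, hAi, -⟩ := h.exists_limit hL hmono hφ (hle hφ)
  refine ⟨A, μ.orderIntegral_eq_of_forall ⟨φ, hmono, hφ, hA⟩ ?_⟩
  rintro J ⟨ψ, hψm, hψ, hJ⟩
  obtain ⟨B, hB, hB0, hBi, -⟩ := h.exists_limit hL hψm hψ (hle hψ)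
  rw [hJ.unique hB, WithTop.coe_inj]
  refine saPart_ext_quadForm fun x => ?_
  rw [← ENNReal.ofReal_eq_ofReal_iff (quadForm_nonneg_of_nonneg hB0 x)
    (quadForm_nonneg_of_nonneg hA0 x), ← hBi, ← hAi]

lemma mem_L1_of_le (h : μ.HasScalarMeasures m) (hL : IsSOTClosed (L : Set (H →L[ℂ] H)))
    {f : X → ℝ} (hf : Measurable f) {S : saPart L} (hS0 : 0 ≤ S)
    (hS : ∀ x, ∫⁻ y, ENNReal.ofReal |f y| ∂(m x) ≤
      ENNReal.ofReal (quadForm (S : H →L[ℂ] H) x)) : f ∈ μ.L1 := by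
  obtain ⟨T, hT⟩ := h.exists_orderIntegral_eq_coe hL
    (ENNReal.measurable_ofReal.comp (measurable_abs.comp hf)) hS0 hS
  exact ⟨hf, by change μ.orderIntegral (fun x => ENNReal.ofReal |f x|) = T at hT; simp [hT]⟩

/-- The order integrals of the positive and the negative part of an integrable function. -/
lemma exists_parts (h : μ.HasScalarMeasures m) (hL : IsSOTClosed (L : Set (H →L[ℂ] H)))
    {f : X → ℝ} (hf : f ∈ μ.L1) : ∃ P N : saPart L,
      μ.orderIntegral (fun x => ENNReal.ofReal (f x)) = P ∧
      μ.orderIntegral (fun x => ENNReal.ofReal (-f x)) = N ∧ μ.integral f = P - N := by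
  obtain ⟨hfm, hft⟩ := hf
  obtain ⟨T, hT⟩ := WithTop.ne_top_iff_exists.1 hft
  obtain ⟨hT0, hTi, -⟩ := h.of_orderIntegral_eq_coe hL hT.symm
  obtain ⟨P, hP⟩ := h.exists_orderIntegral_eq_coe hL (ENNReal.measurable_ofReal.comp hfm) hT0
    fun x => (lintegral_mono fun y => ENNReal.ofReal_le_ofReal (le_abs_self _)).trans (hTi x).le
  obtain ⟨N, hN⟩ := h.exists_orderIntegral_eq_coe hL
    (ENNReal.measurable_ofReal.comp hfm.neg) hT0
    fun x => (lintegral_mono fun y => ENNReal.ofReal_le_ofReal (neg_le_abs _)).trans (hTi x).le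
  refine ⟨P, N, hP, hN, ?_⟩
  simp only [Function.comp_def, Pi.neg_apply] at hP hN
  rw [integral, hP, hN, WithTop.untopD_coe, WithTop.untopD_coe]

lemma integrable_of_mem_L1 (h : μ.HasScalarMeasures m) (hL : IsSOTClosed (L : Set (H →L[ℂ] H)))
    {f : X → ℝ} (hf : f ∈ μ.L1) (x : H) : Integrable f (m x) := by
  obtain ⟨hfm, hft⟩ := hf
  obtain ⟨T, hT⟩ := WithTop.ne_top_iff_exists.1 hft
  refine ⟨hfm.aestronglyMeasurable, ?_⟩
  rw [hasFiniteIntegral_iff_norm]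
  simp only [Real.norm_eq_abs, (h.of_orderIntegral_eq_coe hL hT.symm).2.1 x]
  exact ENNReal.ofReal_lt_top

lemma quadForm_integral (h : μ.HasScalarMeasures m) (hL : IsSOTClosed (L : Set (H →L[ℂ] H)))
    {f : X → ℝ} (hf : f ∈ μ.L1) (x : H) :
    quadForm (μ.integral f : H →L[ℂ] H) x = ∫ y, f y ∂(m x) := by
  obtain ⟨P, N, hP, hN, hI⟩ := h.exists_parts hL hf
  obtain ⟨hP0, hPi, -⟩ := h.of_orderIntegral_eq_coe hL hP
  obtain ⟨hN0, hNi, -⟩ := h.of_orderIntegral_eq_coe hL hN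
  rw [integral_eq_lintegral_pos_part_sub_lintegral_neg_part (h.integrable_of_mem_L1 hL hf x),
    hPi, hNi, ENNReal.toReal_ofReal (quadForm_nonneg_of_nonneg hP0 x),
    ENNReal.toReal_ofReal (quadForm_nonneg_of_nonneg hN0 x), hI, Submodule.coe_sub, quadForm_sub]

lemma eq_integral_iff (h : μ.HasScalarMeasures m) (hL : IsSOTClosed (L : Set (H →L[ℂ] H)))
    {f : X → ℝ} (hf : f ∈ μ.L1) (T : H →L[ℂ] H) :
    (∀ x, inner ℂ x (T x) = ((∫ y, f y ∂(m x) : ℝ) : ℂ)) ↔ T = μ.integral f := by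
  have key : ∀ x, inner ℂ x ((μ.integral f : H →L[ℂ] H) x) = ((∫ y, f y ∂(m x) : ℝ) : ℂ) :=
    fun x => by rw [inner_eq_quadForm (isSelfAdjoint_of_saPart _), h.quadForm_integral hL hf]
  constructor
  · intro hT
    exact eq_of_inner_apply_eq fun x => (hT x).trans (key x).symm
  · rintro rfl; exact key

lemma eq_integral_of_quadForm (h : μ.HasScalarMeasures m)
    (hL : IsSOTClosed (L : Set (H →L[ℂ] H))) {f : X → ℝ} (hf : f ∈ μ.L1) {T : saPart L}
    (hT : ∀ x, quadForm (T : H →L[ℂ] H) x = ∫ y, f y ∂(m x)) : T = μ.integral f :=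
  saPart_ext_quadForm fun x => (hT x).trans (h.quadForm_integral hL hf x).symm

lemma mem_L1_of_bounded (h : μ.HasScalarMeasures m) (hL : IsSOTClosed (L : Set (H →L[ℂ] H)))
    {f : X → ℝ} (hf : Measurable f) {C : ℝ} (hC : ∀ y, |f y| ≤ C) : f ∈ μ.L1 := by
  -- The constant `C` may be negative when `X` is empty.
  have hC' : ∀ y, |f y| ≤ |C| := fun y => (hC y).trans (le_abs_self C)
  refine h.mem_L1_of_le hL hf (S := |C| • μ.value Set.univ)
    (smul_nonneg (abs_nonneg C) (h.value_nonneg _)) fun x => ?_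
  calc ∫⁻ y, ENNReal.ofReal |f y| ∂(m x) ≤ ∫⁻ _, ENNReal.ofReal |C| ∂(m x) :=
        lintegral_mono fun y => ENNReal.ofReal_le_ofReal (hC' y)
    _ = ENNReal.ofReal |C| * m x Set.univ := lintegral_const _
    _ = _ := by
        rw [Submodule.coe_smul, quadForm_smul, ENNReal.ofReal_mul (abs_nonneg C),
          h.measure_eq x .univ]

lemma integral_indicator_one (h : μ.HasScalarMeasures m)
    (hL : IsSOTClosed (L : Set (H →L[ℂ] H))) {Δ : Set X} (hΔ : MeasurableSet Δ) :
    μ.integral (Δ.indicator 1) = μ.value Δ := by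
  have hm : Measurable (Δ.indicator (1 : X → ℝ)) := measurable_one.indicator hΔ
  refine (h.eq_integral_of_quadForm hL (h.mem_L1_of_bounded hL hm (C := 1) fun y => ?_)
    fun x => ?_).symm
  · by_cases hy : y ∈ Δ <;> simp [hy]
  · rw [MeasureTheory.integral_indicator_one hΔ, h.real_eq x Δ hΔ]

/-- Strong σ-additivity. -/
lemma hasSum_value_apply (h : μ.HasScalarMeasures m) {Δ : ℕ → Set X}
    (hΔ : ∀ n, MeasurableSet (Δ n)) (hd : Pairwise (Function.onFun Disjoint Δ)) (x : H) :
    HasSum (fun n => (μ.value (Δ n) : H →L[ℂ] H) x) ((μ.value (⋃ n, Δ n) : H →L[ℂ] H) x) := by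
  set U := μ.value (⋃ n, Δ n)
  let V : Finset ℕ → saPart L := fun s => ∑ n ∈ s, μ.value (Δ n)
  have hq : ∀ s x, quadForm (V s : H →L[ℂ] H) x = (m x).real (⋃ n ∈ s, Δ n) := fun s x => by
    have := h.isFiniteMeasure x
    rw [measureReal_biUnion_finset (fun i _ j _ hij => hd hij) fun n _ => hΔ n]
    simp only [V, Submodule.coe_sum, quadForm_sum, h.real_eq x _ (hΔ _)]
  have hVU : ∀ s, V s ≤ U := fun s => saPart_le_iff.2 fun x => by
    have := h.isFiniteMeasure x
    rw [hq, ← h.real_eq x _ (MeasurableSet.iUnion hΔ)]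
    exact measureReal_mono (Set.iUnion₂_subset fun n _ => Set.subset_iUnion Δ n)
  have hV0 : ∀ s, 0 ≤ V s := fun s => Finset.sum_nonneg fun n _ => h.value_nonneg _
  have hs : Tendsto (fun s => quadForm (V s : H →L[ℂ] H) x) atTop
      (𝓝 (quadForm (U : H →L[ℂ] H) x)) := by
    have := h.isFiniteMeasure x
    have h3 := hasSum_measureReal_iUnion (m x) hΔ hd
    rw [h.real_eq x _ (MeasurableSet.iUnion hΔ)] at h3
    refine h3.congr fun s => ?_
    simp only [V, Submodule.coe_sum, quadForm_sum, h.real_eq x _ (hΔ _)]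
  -- The remainder `U - V s` lies between `0` and `U`, so its strong size is controlled by its form,
  -- which tends to zero.
  have hb : ∀ s, ‖∑ n ∈ s, (μ.value (Δ n) : H →L[ℂ] H) x - (U : H →L[ℂ] H) x‖ ≤
      Real.sqrt (‖(U : H →L[ℂ] H)‖ *
        (quadForm (U : H →L[ℂ] H) x - quadForm (V s : H →L[ℂ] H) x)) := fun s => by
    refine Real.le_sqrt_of_sq_le ?_
    rw [norm_sub_rev]
    have := saPart_norm_apply_sub_sq_le (hVU s) (sub_le_self U (hV0 s)) x
    simpa [V, Submodule.coe_sum] using this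
  rw [HasSum, SummationFilter.unconditional_filter, tendsto_iff_norm_sub_tendsto_zero]
  refine squeeze_zero (fun _ => norm_nonneg _) hb ?_
  have h4 := (Real.continuous_sqrt.tendsto _).comp
    ((tendsto_const_nhds (x := quadForm (U : H →L[ℂ] H) x)).sub hs |>.const_mul
      ‖(U : H →L[ℂ] H)‖)
  simpa [Function.comp_def] using h4

end HasScalarMeasures

end PosMeasure

/-! ### Continuous functions vanishing at infinity -/

section C0

variable {X : Type*} [TopologicalSpace X]

lemma zeroAtInfty_norm_le {f : C₀(X, ℝ)} {C : ℝ} (hC : 0 ≤ C) (h : ∀ x, |f x| ≤ C) : ‖f‖ ≤ C := by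
  rw [← ZeroAtInftyContinuousMap.norm_toBCF_eq_norm]
  exact (BoundedContinuousFunction.norm_le hC).2 h

lemma zeroAtInfty_abs_le_norm (f : C₀(X, ℝ)) (x : X) : |f x| ≤ ‖f‖ := by
  rw [← ZeroAtInftyContinuousMap.norm_toBCF_eq_norm]
  exact f.toBCF.norm_coe_le_norm x

/-- Composition with a continuous contraction that fixes the origin. -/
def zeroAtInftyPostcomp (g : C(ℝ, ℝ)) (hg : ∀ t, |g t| ≤ |t|) (f : C₀(X, ℝ)) : C₀(X, ℝ) where
  toFun x := g (f x)
  continuous_toFun := g.continuous.comp f.continuous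
  zero_at_infty' := by
    have h0 : g 0 = 0 := by simpa using hg 0
    have := (g.continuous.tendsto 0).comp f.zero_at_infty'
    rwa [h0] at this

/-- The positive part of a function that vanishes at infinity. -/
def zeroAtInftyPos (f : C₀(X, ℝ)) : C₀(X, ℝ) :=
  zeroAtInftyPostcomp ⟨fun t => max t 0, by fun_prop⟩
    (fun t => by simpa using abs_max_sub_max_le_abs t 0 0) f

/-- The absolute value of a function that vanishes at infinity. -/
def zeroAtInftyAbs (f : C₀(X, ℝ)) : C₀(X, ℝ) :=
  zeroAtInftyPostcomp ⟨fun t => |t|, by fun_prop⟩ (fun t => by simp) f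

/-- The difference of `f` and its truncation at the levels `±ε`. -/
def zeroAtInftyShrink (ε : ℝ) (hε : 0 ≤ ε) (f : C₀(X, ℝ)) : C₀(X, ℝ) :=
  zeroAtInftyPostcomp ⟨fun t => t - max (-ε) (min t ε), by fun_prop⟩ (fun t => by
    simp only [ContinuousMap.coe_mk]
    rcases le_total t ε with h1 | h1 <;> rcases le_total (-ε) t with h2 | h2 <;>
      rcases abs_cases t with h3 | h3 <;> simp [h1, h2, abs_le, max_eq_right (neg_le_self hε)] <;>
      (try constructor) <;> linarith) f

lemma zeroAtInftyPos_apply (f : C₀(X, ℝ)) (x : X) : zeroAtInftyPos f x = max (f x) 0 := rfl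

lemma norm_zeroAtInftyPos_le (f : C₀(X, ℝ)) : ‖zeroAtInftyPos f‖ ≤ ‖f‖ :=
  zeroAtInfty_norm_le (norm_nonneg _) fun x => by
    refine le_trans ?_ (zeroAtInfty_abs_le_norm f x)
    rw [zeroAtInftyPos_apply]
    simpa using abs_max_sub_max_le_abs (f x) 0 0

lemma zeroAtInftyPos_sub (f : C₀(X, ℝ)) : zeroAtInftyPos f - zeroAtInftyPos (-f) = f := by
  ext x
  simp only [ZeroAtInftyContinuousMap.sub_apply, zeroAtInftyPos_apply,
    ZeroAtInftyContinuousMap.neg_apply]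
  rcases le_total (f x) 0 with h | h <;> simp [h]

lemma zeroAtInftyAbs_apply (f : C₀(X, ℝ)) (x : X) : zeroAtInftyAbs f x = |f x| := rfl

lemma zeroAtInftyShrink_apply {ε : ℝ} (hε : 0 ≤ ε) (f : C₀(X, ℝ)) (x : X) :
    zeroAtInftyShrink ε hε f x = f x - max (-ε) (min (f x) ε) := rfl

/-- The shrunk function vanishes where `|f| < ε`, hence off a compact set. So `C_c(X)` is uniformly
dense in `C₀(X)`. -/
lemma hasCompactSupport_zeroAtInftyShrink [R1Space X] {ε : ℝ} (hε : 0 < ε) (f : C₀(X, ℝ)) :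
    HasCompactSupport (zeroAtInftyShrink ε hε.le f) := by
  have h1 : ∀ᶠ x in cocompact X, |f x| < ε := by
    have := f.zero_at_infty'.abs
    rw [abs_zero] at this
    exact this.eventually (gt_mem_nhds hε)
  obtain ⟨K, hK, hKf⟩ := mem_cocompact.1 h1
  refine HasCompactSupport.intro hK fun x hx => ?_
  have h2 : |f x| < ε := hKf hx
  rw [abs_lt] at h2
  rw [zeroAtInftyShrink_apply, min_eq_left h2.2.le, max_eq_right h2.1.le, sub_self]

lemma abs_zeroAtInftyShrink_sub_le {ε : ℝ} (hε : 0 ≤ ε) (f : C₀(X, ℝ)) (x : X) :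
    |zeroAtInftyShrink ε hε f x - f x| ≤ ε := by
  rw [zeroAtInftyShrink_apply, abs_le]
  have h1 : max (-ε) (min (f x) ε) ≤ ε := max_le (by linarith) (min_le_right _ _)
  have h2 := le_max_left (-ε) (min (f x) ε)
  constructor <;> linarith

/-- A compactly supported function, as a function that vanishes at infinity. -/
def zeroAtInftyOfHasCompactSupport (f : C(X, ℝ)) (hf : HasCompactSupport f) : C₀(X, ℝ) where
  toContinuousMap := f
  zero_at_infty' := hf.is_zero_at_infty

/-- Urysohn's lemma in the form `K ≺ f ≺ V`. -/
lemma exists_setPrec_precSet [T2Space X] [LocallyCompactSpace X] {K V : Set X} (hK : IsCompact K)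
    (hV : IsOpen V) (hKV : K ⊆ V) : ∃ f : C₀(X, ℝ), SetPrec K f ∧ PrecSet f V := by
  obtain ⟨f, h1, h2, h3, h4⟩ := exists_continuousMap_one_of_isCompact_subset_isOpen hK hV hKV
  exact ⟨zeroAtInftyOfHasCompactSupport f h2, ⟨h2, h4, h1⟩, h2, h4, h3⟩

end C0

/-! ### Positive operators on `C₀(X)` -/

section PositiveOperator

variable {X : Type*} [TopologicalSpace X]
  {H : Type*} [NormedAddCommGroup H] [InnerProductSpace ℂ H] [CompleteSpace H]
  {L : Submodule ℂ (H →L[ℂ] H)} {π : C₀(X, ℝ) →ₗ[ℝ] saPart L}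

lemma map_mono_of_nonneg (hπ : ∀ f : C₀(X, ℝ), (∀ x, 0 ≤ f x) → 0 ≤ π f) {f g : C₀(X, ℝ)}
    (h : ∀ x, f x ≤ g x) : π f ≤ π g := by
  rw [← sub_nonneg, ← map_sub]
  exact hπ _ fun x => sub_nonneg.2 (h x)

lemma saPart_norm_mono {S T : saPart L} (hS : 0 ≤ S) (h : S ≤ T) :
    ‖(S : H →L[ℂ] H)‖ ≤ ‖(T : H →L[ℂ] H)‖ :=
  CStarAlgebra.norm_le_norm_of_nonneg_of_le hS h

/-- Positive operators on `C₀(X)` are bounded. -/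
lemma exists_norm_map_le (hπ : ∀ f : C₀(X, ℝ), (∀ x, 0 ≤ f x) → 0 ≤ π f) :
    ∃ C : ℝ, 0 ≤ C ∧ ∀ f, ‖(π f : H →L[ℂ] H)‖ ≤ C * ‖f‖ := by
  suffices h : ∃ C : ℝ, 0 ≤ C ∧ ∀ f : C₀(X, ℝ), (∀ x, 0 ≤ f x) →
      ‖(π f : H →L[ℂ] H)‖ ≤ C * ‖f‖ by
    obtain ⟨C, hC, h⟩ := h
    refine ⟨2 * C, by positivity, fun f => ?_⟩
    have hf : π f = π (zeroAtInftyPos f) - π (zeroAtInftyPos (-f)) := by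
      rw [← map_sub, zeroAtInftyPos_sub]
    have hb : ∀ g : C₀(X, ℝ), ‖(π (zeroAtInftyPos g) : H →L[ℂ] H)‖ ≤ C * ‖g‖ := fun g =>
      (h _ fun x => le_max_right _ _).trans (mul_le_mul_of_nonneg_left (norm_zeroAtInftyPos_le g) hC)
    rw [hf, Submodule.coe_sub]
    have h2 := hb (-f)
    rw [norm_neg] at h2
    linarith [norm_sub_le (π (zeroAtInftyPos f) : H →L[ℂ] H) (π (zeroAtInftyPos (-f))), hb f]
  -- Gliding hump: take `f n ≥ 0` of norm `1` with `‖π(f n)‖ > 4 ^ n`. The sum `F` of the `2⁻ⁿ f n`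
  -- dominates each term, so `‖π(F)‖ > 2 ^ n` for all `n`.
  by_contra! hcon
  have h1 : ∀ n : ℕ, ∃ f : C₀(X, ℝ), (∀ x, 0 ≤ f x) ∧ ‖f‖ = 1 ∧
      (4 : ℝ) ^ n < ‖(π f : H →L[ℂ] H)‖ := by
    intro n
    obtain ⟨f, hf0, hf⟩ := hcon (4 ^ n) (by positivity)
    have hfn : 0 < ‖f‖ := by
      rcases (norm_nonneg f).eq_or_lt with h | h
      · rw [eq_comm, norm_eq_zero] at h
        subst h
        simp at hf
      · exact h
    refine ⟨‖f‖⁻¹ • f, fun x => ?_, ?_, ?_⟩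
    · rw [ZeroAtInftyContinuousMap.smul_apply, smul_eq_mul]
      exact mul_nonneg (by positivity) (hf0 x)
    · rw [norm_smul, norm_inv, norm_norm, inv_mul_cancel₀ hfn.ne']
    · rw [map_smul, Submodule.coe_smul, norm_smul, norm_inv, norm_norm, inv_mul_eq_div,
        lt_div_iff₀ hfn]
      exact hf
  choose f hf0 hf1 hf using h1
  have hs : Summable fun n => ((2 : ℝ)⁻¹ ^ n) • f n := by
    refine Summable.of_norm ?_
    simp only [norm_smul, hf1, mul_one, norm_pow, norm_inv, Real.norm_ofNat]
    exact summable_geometric_of_lt_one (by norm_num) (by norm_num)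
  set F := ∑' n, ((2 : ℝ)⁻¹ ^ n) • f n
  have hle : ∀ n x, ((2 : ℝ)⁻¹ ^ n) * f n x ≤ F x := fun n x => by
    let ev : C₀(X, ℝ) →ₗ[ℝ] ℝ :=
      { toFun := fun g => g x, map_add' := fun _ _ => rfl, map_smul' := fun _ _ => rfl }
    -- Evaluation is continuous, so the norm-convergent series can be compared pointwise with its
    -- terms.
    let evc : C₀(X, ℝ) →L[ℝ] ℝ := ev.mkContinuous 1 fun g => by
      rw [one_mul]; exact zeroAtInfty_abs_le_norm g x
    have h2 := evc.hasSum hs.hasSum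
    exact le_hasSum h2 n fun j _ => mul_nonneg (by positivity) (hf0 j x)
  have hF : ∀ n : ℕ, (2 : ℝ) ^ n < ‖(π F : H →L[ℂ] H)‖ := fun n => by
    have h3 : ‖(π (((2 : ℝ)⁻¹ ^ n) • f n) : H →L[ℂ] H)‖ ≤ ‖(π F : H →L[ℂ] H)‖ := by
      refine saPart_norm_mono (hπ _ fun x => ?_) (map_mono_of_nonneg hπ fun x => ?_)
      · exact mul_nonneg (by positivity) (hf0 n x)
      · exact hle n x
    refine lt_of_lt_of_le ?_ h3
    rw [map_smul, Submodule.coe_smul, norm_smul, norm_pow, norm_inv, Real.norm_ofNat]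
    have : (2 : ℝ) ^ n = (2 : ℝ)⁻¹ ^ n * 4 ^ n := by
      rw [← mul_pow]; norm_num
    rw [this]
    exact mul_lt_mul_of_pos_left (hf n) (by positivity)
  obtain ⟨n, hn⟩ := pow_unbounded_of_one_lt ‖(π F : H →L[ℂ] H)‖ (one_lt_two : (1 : ℝ) < 2)
  exact absurd (hF n) hn.not_gt

/-- Apply `norm_apply_sq_le` to the positive and negative parts and use `‖a - b‖² ≤ 2‖a‖² + 2‖b‖²`.
Smallness of `|f|` in `L¹(μ_x)` thus makes `π(f) x` small when `‖f‖` stays bounded. -/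
lemma norm_map_apply_sq_le (hπ : ∀ f : C₀(X, ℝ), (∀ x, 0 ≤ f x) → 0 ≤ π f) {C : ℝ}
    (hC : ∀ f, ‖(π f : H →L[ℂ] H)‖ ≤ C * ‖f‖) (hC0 : 0 ≤ C) (f : C₀(X, ℝ)) (x : H) :
    ‖(π f : H →L[ℂ] H) x‖ ^ 2 ≤
      2 * C * ‖f‖ * quadForm (π (zeroAtInftyAbs f) : H →L[ℂ] H) x := by
  have hb : ∀ g : C₀(X, ℝ), ‖(π (zeroAtInftyPos g) : H →L[ℂ] H) x‖ ^ 2 ≤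
      C * ‖g‖ * quadForm (π (zeroAtInftyPos g) : H →L[ℂ] H) x := fun g => by
    have h0 : (0 : saPart L) ≤ π (zeroAtInftyPos g) := hπ _ fun x => le_max_right _ _
    refine (norm_apply_sq_le h0 x).trans (mul_le_mul_of_nonneg_right
      ((hC _).trans (mul_le_mul_of_nonneg_left (norm_zeroAtInftyPos_le g) hC0)) (quadForm_nonneg h0 x))
  have h2 : zeroAtInftyAbs f = zeroAtInftyPos f + zeroAtInftyPos (-f) := by
    ext x
    simp only [ZeroAtInftyContinuousMap.add_apply, zeroAtInftyPos_apply, zeroAtInftyAbs_apply,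
      ZeroAtInftyContinuousMap.neg_apply]
    rcases le_total (f x) 0 with h | h <;> simp [h, abs_of_nonpos, abs_of_nonneg]
  have h3 : (π f : H →L[ℂ] H) x = (π (zeroAtInftyPos f) : H →L[ℂ] H) x -
      (π (zeroAtInftyPos (-f)) : H →L[ℂ] H) x := by
    rw [← sub_apply, ← Submodule.coe_sub, ← map_sub, zeroAtInftyPos_sub]
  have h4 := hb f
  have h5 := hb (-f)
  rw [norm_neg] at h5
  rw [h3, h2, map_add, Submodule.coe_add, quadForm_add]
  set a := (π (zeroAtInftyPos f) : H →L[ℂ] H) x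
  set b := (π (zeroAtInftyPos (-f)) : H →L[ℂ] H) x
  have h6 : ‖a - b‖ ^ 2 ≤ (‖a‖ + ‖b‖) ^ 2 := by gcongr; exact norm_sub_le a b
  nlinarith [sq_nonneg (‖a‖ - ‖b‖)]

end PositiveOperator

/-! ### The scalar measures of a positive operator -/

section ScalarMeasures

open CompactlySupported

variable {X : Type*} [TopologicalSpace X] [T2Space X] [LocallyCompactSpace X]
  [MeasurableSpace X] [BorelSpace X]
  {H : Type*} [NormedAddCommGroup H] [InnerProductSpace ℂ H] [CompleteSpace H]
  {L : Submodule ℂ (H →L[ℂ] H)} {π : C₀(X, ℝ) →ₗ[ℝ] saPart L}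

/-- The positive functional `f ↦ ⟨x, π(f) x⟩` on `C_c(X)`. -/
def scalarFunctional (hπ : ∀ f : C₀(X, ℝ), (∀ x, 0 ≤ f x) → 0 ≤ π f) (x : H) :
    C_c(X, ℝ) →ₚ[ℝ] ℝ :=
  PositiveLinearMap.mk₀
    { toFun := fun f => quadForm (π (f : C₀(X, ℝ)) : H →L[ℂ] H) x
      map_add' := fun f g => by
        rw [show ((f + g : C_c(X, ℝ)) : C₀(X, ℝ)) = (f : C₀(X, ℝ)) + g from rfl, map_add,
          Submodule.coe_add, quadForm_add]
      map_smul' := fun r f => by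
        rw [show ((r • f : C_c(X, ℝ)) : C₀(X, ℝ)) = r • (f : C₀(X, ℝ)) from rfl, map_smul,
          Submodule.coe_smul, quadForm_smul]
        rfl }
    fun f hf => quadForm_nonneg (hπ _ hf : (0 : saPart L) ≤ _) x

/-- The Riesz measure of the functional `f ↦ ⟨x, π(f) x⟩`. -/
def scalarMeasure (hπ : ∀ f : C₀(X, ℝ), (∀ x, 0 ≤ f x) → 0 ≤ π f) (x : H) : Measure X :=
  RealRMK.rieszMeasure (scalarFunctional hπ x)

instance (hπ : ∀ f : C₀(X, ℝ), (∀ x, 0 ≤ f x) → 0 ≤ π f) (x : H) :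
    (scalarMeasure hπ x).Regular :=
  RealRMK.regular_rieszMeasure _

/-- The constant `1` need not be in `C₀(X)`. Inner regularity replaces it by functions `f` with `K ≺
f`, for which `μ_x(K) ≤ ⟨x, π(f) x⟩ ≤ C ‖x‖²`. -/
instance (hπ : ∀ f : C₀(X, ℝ), (∀ x, 0 ≤ f x) → 0 ≤ π f) (x : H) :
    IsFiniteMeasure (scalarMeasure hπ x) := by
  obtain ⟨C, hC0, hC⟩ := exists_norm_map_le hπ
  refine ⟨lt_of_le_of_lt ?_ (ENNReal.ofReal_lt_top (r := C * ‖x‖ ^ 2))⟩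
  rw [isOpen_univ.measure_eq_iSup_isCompact]
  refine iSup₂_le fun K _ => iSup_le fun hK => ?_
  obtain ⟨f, ⟨hfc, hf01, hf1⟩, -⟩ := exists_setPrec_precSet hK isOpen_univ (Set.subset_univ K)
  let g : C_c(X, ℝ) := ⟨f, hfc⟩
  refine (RealRMK.rieszMeasure_le_of_eq_one (scalarFunctional hπ x) (f := g)
    (fun y => (hf01 y).1) hK hf1).trans (ENNReal.ofReal_le_ofReal ?_)
  refine (quadForm_le_norm _ x).trans (mul_le_mul_of_nonneg_right ?_ (by positivity))
  refine (hC _).trans (mul_le_of_le_one_right hC0 ?_)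
  exact zeroAtInfty_norm_le zero_le_one fun y => abs_le.2 ⟨neg_one_lt_zero.le.trans (hf01 y).1, (hf01 y).2⟩

lemma integrable_scalarMeasure (hπ : ∀ f : C₀(X, ℝ), (∀ x, 0 ≤ f x) → 0 ≤ π f) (x : H)
    (f : C₀(X, ℝ)) : Integrable f (scalarMeasure hπ x) :=
  Integrable.of_bound f.continuous.measurable.aestronglyMeasurable ‖f‖
    (Eventually.of_forall fun y => zeroAtInfty_abs_le_norm f y)

/-- Riesz gives this on `C_c(X)`. Both sides are continuous in the uniform norm, since `π` is
bounded and the measure is finite, so it extends to `C₀(X)`. -/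
lemma quadForm_map_eq_integral (hπ : ∀ f : C₀(X, ℝ), (∀ x, 0 ≤ f x) → 0 ≤ π f)
    (f : C₀(X, ℝ)) (x : H) :
    quadForm (π f : H →L[ℂ] H) x = ∫ y, f y ∂(scalarMeasure hπ x) := by
  have hc : ∀ g : C₀(X, ℝ), HasCompactSupport g →
      quadForm (π g : H →L[ℂ] H) x = ∫ y, g y ∂(scalarMeasure hπ x) := fun g hg =>
    (RealRMK.integral_rieszMeasure (scalarFunctional hπ x) ⟨g, hg⟩).symm
  obtain ⟨C, hC0, hC⟩ := exists_norm_map_le hπ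
  have he : ∀ n : ℕ, (0 : ℝ) < 1 / ((n : ℝ) + 1) := fun n => Nat.one_div_pos_of_nat
  let g : ℕ → C₀(X, ℝ) := fun n => zeroAtInftyShrink _ (he n).le f
  have hgf : ∀ n y, |g n y - f y| ≤ 1 / ((n : ℝ) + 1) := fun n y =>
    abs_zeroAtInftyShrink_sub_le (he n).le f y
  have h1 : Tendsto (fun n => quadForm (π (g n) : H →L[ℂ] H) x) atTop
      (𝓝 (quadForm (π f : H →L[ℂ] H) x)) := by
    refine tendsto_quadForm (tendsto_iff_norm_sub_tendsto_zero.2 ?_)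
    refine squeeze_zero (fun _ => norm_nonneg _) (g := fun n : ℕ => C * (1 / ((n : ℝ) + 1)) * ‖x‖)
      (fun n => ?_) ?_
    · rw [← sub_apply, ← Submodule.coe_sub, ← map_sub]
      refine (ContinuousLinearMap.le_opNorm _ _).trans
        (mul_le_mul_of_nonneg_right ((hC _).trans ?_) (norm_nonneg x))
      exact mul_le_mul_of_nonneg_left (zeroAtInfty_norm_le (he n).le (hgf n)) hC0
    · simpa using (tendsto_one_div_add_atTop_nhds_zero_nat.const_mul C).mul_const ‖x‖
  have h2 : Tendsto (fun n => ∫ y, g n y ∂(scalarMeasure hπ x)) atTop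
      (𝓝 (∫ y, f y ∂(scalarMeasure hπ x))) := by
    refine tendsto_iff_norm_sub_tendsto_zero.2 ?_
    refine squeeze_zero (fun _ => norm_nonneg _)
      (g := fun n : ℕ => 1 / ((n : ℝ) + 1) * (scalarMeasure hπ x).real Set.univ) (fun n => ?_) ?_
    · rw [← integral_sub (integrable_scalarMeasure hπ x _) (integrable_scalarMeasure hπ x _)]
      exact norm_integral_le_of_norm_le_const (Eventually.of_forall (hgf n))
    · simpa using tendsto_one_div_add_atTop_nhds_zero_nat.mul_const
        ((scalarMeasure hπ x).real Set.univ)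
  refine tendsto_nhds_unique h1 (h2.congr fun n => (hc _ ?_).symm)
  exact hasCompactSupport_zeroAtInftyShrink (he n) f

end ScalarMeasures

/-! ### The measure that represents a positive operator -/

section Construction

variable {X : Type*} [TopologicalSpace X] [T2Space X]
  [MeasurableSpace X] [BorelSpace X]
  {H : Type*}

/-- Take the union of the compact sets and the intersection of the open sets that serve the
individual `x ∈ F`; finiteness of `F` keeps them compact and open. -/
lemma exists_compact_open_approx (m : H → Measure X) [∀ x, (m x).Regular]
    [∀ x, IsFiniteMeasure (m x)] {Δ : Set X} (hΔ : MeasurableSet Δ) (F : Finset H) {ε : ℝ}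
    (hε : 0 < ε) : ∃ K V : Set X, IsCompact K ∧ IsOpen V ∧ K ⊆ Δ ∧ Δ ⊆ V ∧
      ∀ x ∈ F, (m x).real (V \ K) ≤ ε := by
  have hε2 : ENNReal.ofReal (ε / 2) ≠ 0 := by simpa using hε
  choose K hKΔ hK hKε using fun x =>
    hΔ.exists_isCompact_sdiff_lt (μ := m x) (measure_ne_top _ _) hε2
  choose V hΔV hV _ hVε using fun x =>
    hΔ.exists_isOpen_sdiff_lt (μ := m x) (measure_ne_top _ _) hε2
  refine ⟨⋃ x ∈ F, K x, ⋂ x ∈ F, V x, F.isCompact_biUnion fun x _ => hK x,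
    isOpen_biInter_finset fun x _ => hV x, Set.iUnion₂_subset fun x _ => hKΔ x,
    Set.subset_iInter₂ fun x _ => hΔV x, fun x hx => ?_⟩
  refine ENNReal.toReal_le_of_le_ofReal hε.le ?_
  calc m x ((⋂ x ∈ F, V x) \ ⋃ x ∈ F, K x) ≤ m x ((V x \ Δ) ∪ (Δ \ K x)) := by
        refine measure_mono fun y hy => ?_
        have h1 : y ∈ V x := Set.mem_iInter₂.1 hy.1 x hx
        have h2 : y ∉ K x := fun h => hy.2 (Set.mem_iUnion₂.2 ⟨x, hx, h⟩)
        by_cases hyΔ : y ∈ Δ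
        · exact Or.inr ⟨hyΔ, h2⟩
        · exact Or.inl ⟨h1, hyΔ⟩
    _ ≤ m x (V x \ Δ) + m x (Δ \ K x) := measure_union_le _ _
    _ ≤ ENNReal.ofReal (ε / 2) + ENNReal.ofReal (ε / 2) := add_le_add (hVε x).le (hKε x).le
    _ = ENNReal.ofReal ε := by
        rw [← ENNReal.ofReal_add (by positivity) (by positivity), add_halves]

lemma isLUB_measureReal_isCompact (ρ : Measure X) [ρ.Regular] [IsFiniteMeasure ρ] {Δ : Set X}
    (hΔ : MeasurableSet Δ) :
    IsLUB {r | ∃ K : Set X, IsCompact K ∧ K ⊆ Δ ∧ r = ρ.real K} (ρ.real Δ) := by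
  refine ⟨?_, fun b hb => le_of_forall_pos_le_add fun ε hε => ?_⟩
  · rintro _ ⟨K, -, hK, rfl⟩
    exact measureReal_mono hK
  · obtain ⟨K, V, hK, -, hKΔ, hΔV, h⟩ :=
      exists_compact_open_approx (fun _ : Unit => ρ) hΔ {()} hε
    have h1 := hb ⟨K, hK, hKΔ, rfl⟩
    have h2 : ρ.real (Δ \ K) ≤ ε :=
      (measureReal_mono (Set.sdiff_subset_sdiff_left hΔV)).trans (h () (by simp))
    have h3 := measureReal_sdiff_add_inter (μ := ρ) (s := Δ) (t := K) hK.measurableSet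
    rw [Set.inter_eq_self_of_subset_right hKΔ] at h3
    linarith

lemma isGLB_measureReal_isOpen (ρ : Measure X) [ρ.Regular] [IsFiniteMeasure ρ] {Δ : Set X}
    (hΔ : MeasurableSet Δ) :
    IsGLB {r | ∃ V : Set X, IsOpen V ∧ Δ ⊆ V ∧ r = ρ.real V} (ρ.real Δ) := by
  refine ⟨?_, fun b hb => le_of_forall_pos_le_add fun ε hε => ?_⟩
  · rintro _ ⟨K, -, hK, rfl⟩
    exact measureReal_mono hK
  · obtain ⟨K, V, -, hV, hKΔ, hΔV, h⟩ :=
      exists_compact_open_approx (fun _ : Unit => ρ) hΔ {()} hε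
    have h1 := hb ⟨V, hV, hΔV, rfl⟩
    have h2 : ρ.real (V \ Δ) ≤ ε :=
      (measureReal_mono (Set.sdiff_subset_sdiff_right hKΔ)).trans (h () (by simp))
    have h3 := measureReal_sdiff_add_inter (μ := ρ) (s := V) (t := Δ) hΔ
    rw [Set.inter_eq_self_of_subset_right hΔV] at h3
    linarith

lemma tendsto_div_snd_add_one (c : ℝ) :
    Tendsto (fun i : Finset H × ℕ => c / ((i.2 : ℝ) + 1)) atTop (𝓝 0) := by
  have h : Tendsto (fun n : ℕ => c / ((n : ℝ) + 1)) atTop (𝓝 0) := by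
    simpa [div_eq_mul_inv] using tendsto_one_div_add_atTop_nhds_zero_nat.const_mul c
  rw [← prod_atTop_atTop_eq]
  exact h.comp tendsto_snd

variable [LocallyCompactSpace X] [NormedAddCommGroup H] [InnerProductSpace ℂ H] [CompleteSpace H]
  {L : Submodule ℂ (H →L[ℂ] H)} {π : C₀(X, ℝ) →ₗ[ℝ] saPart L}

/-- If `K ≺ h ≺ V` and `K ⊆ Δ ⊆ V`, then `h` agrees with the indicator off `V \ K` and differs from
it by at most `1` there. -/
lemma exists_integral_abs_sub_indicator_le
    (hπ : ∀ f : C₀(X, ℝ), (∀ x, 0 ≤ f x) → 0 ≤ π f) {Δ : Set X} (hΔ : MeasurableSet Δ)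
    (F : Finset H) {ε : ℝ} (hε : 0 < ε) :
    ∃ h : C₀(X, ℝ), HasCompactSupport h ∧ (∀ y, 0 ≤ h y ∧ h y ≤ 1) ∧
      ∀ x ∈ F, ∫ y, |h y - Δ.indicator 1 y| ∂(scalarMeasure hπ x) ≤ ε := by
  obtain ⟨K, V, hK, hV, hKΔ, hΔV, hKV⟩ :=
    exists_compact_open_approx (scalarMeasure hπ) hΔ F hε
  obtain ⟨h, ⟨hc, h01, hK1⟩, -, -, hsupp⟩ := exists_setPrec_precSet hK hV (hKΔ.trans hΔV)
  refine ⟨h, hc, h01, fun x hx => ?_⟩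
  have hm : MeasurableSet (V \ K) := hV.measurableSet.diff hK.measurableSet
  calc ∫ y, |h y - Δ.indicator 1 y| ∂(scalarMeasure hπ x)
      ≤ ∫ y, (V \ K).indicator 1 y ∂(scalarMeasure hπ x) := by
        refine integral_mono_of_nonneg (Eventually.of_forall fun y => abs_nonneg _)
          ((integrable_const (1 : ℝ)).indicator hm) (Eventually.of_forall fun y => ?_)
        change |h y - Δ.indicator 1 y| ≤ (V \ K).indicator 1 y
        by_cases hyK : y ∈ K
        · simp [hK1 y hyK, hKΔ hyK, hyK]
        by_cases hyV : y ∈ V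
        · rw [Set.indicator_of_mem (show y ∈ V \ K from ⟨hyV, hyK⟩), Pi.one_apply, abs_le]
          by_cases hyΔ : y ∈ Δ <;> simp [hyΔ] <;> constructor <;> linarith [(h01 y).1, (h01 y).2]
        · have h0 : h y = 0 := image_eq_zero_of_notMem_tsupport fun hy => hyV (hsupp hy)
          have hyΔ : y ∉ Δ := fun hy => hyV (hΔV hy)
          simp [h0, hyΔ, hyV]
    _ = (scalarMeasure hπ x).real (V \ K) := integral_indicator_one hm
    _ ≤ ε := hKV x hx

/-- The net `π(h i)` is bounded, and strongly Cauchy by `norm_map_apply_sq_le`; its limit has the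
right form by `L¹` convergence. The net is part of the conclusion because the equality of the
generated subspaces uses it. -/
lemma exists_value (hπ : ∀ f : C₀(X, ℝ), (∀ x, 0 ≤ f x) → 0 ≤ π f)
    (hL : IsSOTClosed (L : Set (H →L[ℂ] H))) {Δ : Set X} (hΔ : MeasurableSet Δ) :
    ∃ T : saPart L, (∀ x, (scalarMeasure hπ x).real Δ = quadForm (T : H →L[ℂ] H) x) ∧
      ∃ h : Finset H × ℕ → C₀(X, ℝ), (∀ i, HasCompactSupport (h i)) ∧
        ∀ x, Tendsto (fun i => (π (h i) : H →L[ℂ] H) x) atTop (𝓝 ((T : H →L[ℂ] H) x)) := by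
  obtain ⟨C, hC0, hC⟩ := exists_norm_map_le hπ
  choose h hc h01 hh using fun i : Finset H × ℕ =>
    exists_integral_abs_sub_indicator_le hπ hΔ i.1 (Nat.one_div_pos_of_nat (α := ℝ) (n := i.2))
  have hint : ∀ i x, Integrable (fun y => h i y - Δ.indicator 1 y) (scalarMeasure hπ x) :=
    fun i x => (integrable_scalarMeasure hπ x (h i)).sub
      ((integrable_const (1 : ℝ)).indicator hΔ)
  have hcau : ∀ x, Cauchy (map (fun i => (π (h i) : H →L[ℂ] H) x) atTop) := by
    intro x
    classical
    refine Metric.cauchySeq_iff'.2 fun ε hε => ?_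
    -- The constant is `2C` from `norm_map_apply_sq_le` times `2`, as both functions are within
    -- `1/(n+1)` of the indicator; their difference has norm at most `1`.
    have hlim : ∀ᶠ i : Finset H × ℕ in atTop, 4 * C / ((i.2 : ℝ) + 1) < ε ^ 2 :=
      (tendsto_div_snd_add_one (4 * C)).eventually (gt_mem_nhds (by positivity))
    obtain ⟨⟨F, n⟩, hFn, hxF⟩ := (hlim.and (eventually_ge_atTop ({x}, 0))).exists
    have hxF : x ∈ F := hxF.1 (by simp)
    refine ⟨(F, n), ?_⟩
    rintro ⟨F', n'⟩ ⟨hF', hn'⟩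
    simp only at hF' hn' hFn
    rw [dist_eq_norm]
    refine lt_of_pow_lt_pow_left₀ 2 hε.le (lt_of_le_of_lt ?_ hFn)
    rw [← sub_apply, ← Submodule.coe_sub, ← map_sub]
    refine (norm_map_apply_sq_le hπ hC hC0 _ x).trans ?_
    have hn1 : ‖h (F', n') - h (F, n)‖ ≤ 1 := zeroAtInfty_norm_le zero_le_one fun y => by
      rw [ZeroAtInftyContinuousMap.sub_apply, abs_le]
      constructor <;> linarith [(h01 (F', n') y).1, (h01 (F', n') y).2, (h01 (F, n) y).1,
        (h01 (F, n) y).2]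
    have h1 := hh (F', n') x (hF' hxF)
    have h2 := hh (F, n) x hxF
    have h3 : (1 : ℝ) / ((n' : ℝ) + 1) ≤ 1 / ((n : ℝ) + 1) := by gcongr
    have hq : quadForm (π (zeroAtInftyAbs (h (F', n') - h (F, n))) : H →L[ℂ] H) x ≤
        2 / ((n : ℝ) + 1) := by
      rw [quadForm_map_eq_integral hπ]
      calc ∫ y, zeroAtInftyAbs (h (F', n') - h (F, n)) y ∂(scalarMeasure hπ x)
          ≤ ∫ y, (|h (F', n') y - Δ.indicator 1 y| + |h (F, n) y - Δ.indicator 1 y|)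
            ∂(scalarMeasure hπ x) := by
            refine integral_mono (integrable_scalarMeasure hπ x _)
              ((hint (F', n') x).abs.add (hint (F, n) x).abs) fun y => ?_
            rw [zeroAtInftyAbs_apply, ZeroAtInftyContinuousMap.sub_apply]
            simpa using abs_sub (h (F', n') y - Δ.indicator 1 y) (h (F, n) y - Δ.indicator 1 y)
        _ = ∫ y, |h (F', n') y - Δ.indicator 1 y| ∂(scalarMeasure hπ x) +
            ∫ y, |h (F, n) y - Δ.indicator 1 y| ∂(scalarMeasure hπ x) :=
            integral_add (hint (F', n') x).abs (hint (F, n) x).abs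
        _ ≤ 1 / ((n : ℝ) + 1) + 1 / ((n : ℝ) + 1) := add_le_add (h1.trans h3) h2
        _ = _ := by ring
    calc 2 * C * ‖h (F', n') - h (F, n)‖ *
          quadForm (π (zeroAtInftyAbs (h (F', n') - h (F, n))) : H →L[ℂ] H) x
        ≤ 2 * C * 1 * (2 / ((n : ℝ) + 1)) := by
          gcongr
          exact quadForm_nonneg (hπ _ fun y => abs_nonneg _ : (0 : saPart L) ≤ _) x
      _ = _ := by ring
  classical
  obtain ⟨T, hT⟩ := exists_saPart_limit hL (C := C * 1) (fun i => (hC (h i)).trans (by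
    refine mul_le_mul_of_nonneg_left (zeroAtInfty_norm_le zero_le_one fun y => ?_) hC0
    exact abs_le.2 ⟨neg_one_lt_zero.le.trans (h01 i y).1, (h01 i y).2⟩)) hcau
  refine ⟨T, fun x => ?_, h, hc, hT⟩
  refine tendsto_nhds_unique ?_ (tendsto_quadForm (hT x))
  rw [tendsto_iff_norm_sub_tendsto_zero]
  refine squeeze_zero' (Eventually.of_forall fun _ => norm_nonneg _) ?_
    (tendsto_div_snd_add_one 1)
  filter_upwards [eventually_ge_atTop (({x} : Finset H), 0)] with i hi
  refine le_trans ?_ (hh i x (hi.1 (by simp)))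
  have hind : Integrable (Δ.indicator (1 : X → ℝ)) (scalarMeasure hπ x) :=
    (integrable_const (1 : ℝ)).indicator hΔ
  rw [quadForm_map_eq_integral hπ, ← integral_indicator_one hΔ,
    ← integral_sub (integrable_scalarMeasure hπ x _) hind]
  exact norm_integral_le_integral_norm _

open Classical in
/-- The regular Borel measure that represents a positive operator on `C₀(X)`. -/
def representingMeasure (hπ : ∀ f : C₀(X, ℝ), (∀ x, 0 ≤ f x) → 0 ≤ π f)
    (hL : IsSOTClosed (L : Set (H →L[ℂ] H))) : PosMeasure X (saPart L) :=
  PosMeasure.ofScalarMeasures (scalarMeasure hπ) inferInstance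
    (fun Δ => if hΔ : MeasurableSet Δ then (exists_value hπ hL hΔ).choose else 0)
    (fun Δ hΔ => dif_neg hΔ)
    (fun x Δ hΔ => by rw [dif_pos hΔ]; exact (exists_value hπ hL hΔ).choose_spec.1 x)

lemma hasScalarMeasures_representingMeasure
    (hπ : ∀ f : C₀(X, ℝ), (∀ x, 0 ≤ f x) → 0 ≤ π f) (hL : IsSOTClosed (L : Set (H →L[ℂ] H))) :
    (representingMeasure hπ hL).HasScalarMeasures (scalarMeasure hπ) :=
  PosMeasure.hasScalarMeasures_ofScalarMeasures _ _ _ _ _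

variable {hπ : ∀ f : C₀(X, ℝ), (∀ x, 0 ≤ f x) → 0 ≤ π f} {μ : PosMeasure X (saPart L)}

open PosMeasure

/-- Regularity of every `μ_x` gives the supremum and the infimum form by form. -/
lemma isRegularBorel_of_hasScalarMeasures (h : μ.HasScalarMeasures (scalarMeasure hπ)) :
    μ.IsRegularBorel where
  isBorel K _ := h.ne_top K
  innerRegularAt V hV := by
    have key : IsLUB {T : saPart L | ∃ K : Set X, IsCompact K ∧ K ⊆ V ∧ T = μ.value K}
        (μ.value V) := by
      refine isLUB_of_quadForm fun x => ?_
      rw [← h.real_eq x V hV.measurableSet]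
      convert isLUB_measureReal_isCompact (scalarMeasure hπ x) hV.measurableSet using 1
      ext r
      constructor
      · rintro ⟨_, ⟨K, hK, hKV, rfl⟩, rfl⟩
        exact ⟨K, hK, hKV, (h.real_eq x K hK.measurableSet).symm⟩
      · rintro ⟨K, hK, hKV, rfl⟩
        exact ⟨_, ⟨K, hK, hKV, rfl⟩, (h.real_eq x K hK.measurableSet).symm⟩
    have h1 := isLUB_withTop_coe key
    rw [h.coe_value] at h1
    unfold InnerRegularAt
    convert h1 using 1
    ext T
    constructor
    · rintro ⟨K, hK, hKV, rfl⟩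
      exact ⟨_, ⟨K, hK, hKV, rfl⟩, h.coe_value K⟩
    · rintro ⟨_, ⟨K, hK, hKV, rfl⟩, rfl⟩
      exact ⟨K, hK, hKV, h.coe_value K⟩
  outerRegularAt Δ hΔ := by
    have key : IsGLB {T : saPart L | ∃ V : Set X, IsOpen V ∧ Δ ⊆ V ∧ T = μ.value V}
        (μ.value Δ) := by
      refine isGLB_of_quadForm fun x => ?_
      rw [← h.real_eq x Δ hΔ]
      convert isGLB_measureReal_isOpen (scalarMeasure hπ x) hΔ using 1
      ext r
      constructor
      · rintro ⟨_, ⟨V, hV, hΔV, rfl⟩, rfl⟩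
        exact ⟨V, hV, hΔV, (h.real_eq x V hV.measurableSet).symm⟩
      · rintro ⟨V, hV, hΔV, rfl⟩
        exact ⟨_, ⟨V, hV, hΔV, rfl⟩, (h.real_eq x V hV.measurableSet).symm⟩
    have h1 := isGLB_withTop_coe key ⟨_, Set.univ, isOpen_univ, Set.subset_univ Δ, rfl⟩
    rw [h.coe_value] at h1
    unfold OuterRegularAt
    convert h1 using 1
    ext T
    constructor
    · rintro ⟨V, hV, hΔV, rfl⟩
      exact ⟨_, ⟨V, hV, hΔV, rfl⟩, h.coe_value V⟩
    · rintro ⟨_, ⟨V, hV, hΔV, rfl⟩, rfl⟩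
      exact ⟨V, hV, hΔV, h.coe_value V⟩

lemma representsOn_of_hasScalarMeasures (h : μ.HasScalarMeasures (scalarMeasure hπ))
    (hL : IsSOTClosed (L : Set (H →L[ℂ] H))) (S : Set C₀(X, ℝ)) : RepresentsOn μ π S := by
  intro f _
  have hf : ⇑f ∈ μ.L1 := h.mem_L1_of_bounded hL f.continuous.measurable
    (zeroAtInfty_abs_le_norm f)
  exact ⟨hf, h.eq_integral_of_quadForm hL hf (quadForm_map_eq_integral hπ f)⟩

/-- Form by form: `f ≺ V` gives `∫ f ≤ μ_x(V)`, while `K ≺ f ≺ V` gives `μ_x(K) ≤ ∫ f`, and such `K`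
exhaust `V` in measure. -/
lemma isLUB_map_precSet (h : μ.HasScalarMeasures (scalarMeasure hπ)) {V : Set X}
    (hV : IsOpen V) : IsLUB (π '' {f | PrecSet f V}) (μ.value V) := by
  refine isLUB_of_quadForm fun x => ?_
  rw [← h.real_eq x V hV.measurableSet]
  have hlub := isLUB_measureReal_isCompact (scalarMeasure hπ x) hV.measurableSet
  refine ⟨?_, fun b hb => hlub.2 ?_⟩
  · rintro _ ⟨_, ⟨f, ⟨-, hf01, hfs⟩, rfl⟩, rfl⟩
    change quadForm _ _ ≤ _
    rw [quadForm_map_eq_integral hπ, ← integral_indicator_one hV.measurableSet]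
    refine integral_mono (integrable_scalarMeasure hπ x f)
      ((integrable_const (1 : ℝ)).indicator hV.measurableSet) fun y => ?_
    by_cases hy : y ∈ V
    · simpa [hy] using (hf01 y).2
    · simp [hy, image_eq_zero_of_notMem_tsupport fun h => hy (hfs h)]
  · rintro _ ⟨K, hK, hKV, rfl⟩
    obtain ⟨f, ⟨-, hf01, hf1⟩, hfV⟩ := exists_setPrec_precSet hK hV hKV
    refine le_trans ?_ (hb ⟨_, ⟨f, hfV, rfl⟩, rfl⟩)
    change _ ≤ quadForm _ _
    rw [quadForm_map_eq_integral hπ, ← integral_indicator_one hK.measurableSet]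
    refine integral_mono ((integrable_const (1 : ℝ)).indicator hK.measurableSet)
      (integrable_scalarMeasure hπ x f) fun y => ?_
    by_cases hy : y ∈ K
    · simp [hy, hf1 y hy]
    · simpa [hy] using (hf01 y).1

/-- Dual to the open case, with open neighbourhoods of `K` approximating it from outside. -/
lemma isGLB_map_setPrec (h : μ.HasScalarMeasures (scalarMeasure hπ)) {K : Set X}
    (hK : IsCompact K) : IsGLB (π '' {f | SetPrec K f}) (μ.value K) := by
  refine isGLB_of_quadForm fun x => ?_
  rw [← h.real_eq x K hK.measurableSet]
  have hglb := isGLB_measureReal_isOpen (scalarMeasure hπ x) hK.measurableSet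
  refine ⟨?_, fun b hb => hglb.2 ?_⟩
  · rintro _ ⟨_, ⟨f, ⟨-, hf01, hf1⟩, rfl⟩, rfl⟩
    change _ ≤ quadForm _ _
    rw [quadForm_map_eq_integral hπ, ← integral_indicator_one hK.measurableSet]
    refine integral_mono ((integrable_const (1 : ℝ)).indicator hK.measurableSet)
      (integrable_scalarMeasure hπ x f) fun y => ?_
    by_cases hy : y ∈ K
    · simp [hy, hf1 y hy]
    · simpa [hy] using (hf01 y).1
  · rintro _ ⟨V, hV, hKV, rfl⟩
    obtain ⟨f, hfK, -, hf01, hfs⟩ := exists_setPrec_precSet hK hV hKV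
    refine (hb ⟨_, ⟨f, hfK, rfl⟩, rfl⟩).trans ?_
    change quadForm _ _ ≤ _
    rw [quadForm_map_eq_integral hπ, ← integral_indicator_one hV.measurableSet]
    refine integral_mono (integrable_scalarMeasure hπ x f)
      ((integrable_const (1 : ℝ)).indicator hV.measurableSet) fun y => ?_
    by_cases hy : y ∈ V
    · simpa [hy] using (hf01 y).2
    · simp [hy, image_eq_zero_of_notMem_tsupport fun h => hy (hfs h)]

end Construction

/-! ### Uniqueness of the representing measure -/

section Uniqueness

open PosMeasure

variable {X : Type*} [TopologicalSpace X] [MeasurableSpace X]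
  {H : Type*} [NormedAddCommGroup H] [InnerProductSpace ℂ H] [CompleteSpace H]
  {L : Submodule ℂ (H →L[ℂ] H)} {π : C₀(X, ℝ) → saPart L}

lemma RepresentsOn.orderIntegral_eq {ν : PosMeasure X (saPart L)} {S : Set C₀(X, ℝ)}
    (hν : RepresentsOn ν π S) {f : C₀(X, ℝ)} (hf : f ∈ S) (h0 : ∀ x, 0 ≤ f x) :
    ν.orderIntegral (fun x => ENNReal.ofReal (f x)) = (π f : WithTop (saPart L)) := by
  obtain ⟨⟨-, h1⟩, h2⟩ := hν f hf
  simp only [fun x => abs_of_nonneg (h0 x)] at h1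
  rw [ν.integral_of_nonneg h0] at h2
  obtain ⟨T, hT⟩ := WithTop.ne_top_iff_exists.1 h1
  rw [h2, ← hT, WithTop.untopD_coe]

/-- Let `c` increase to `1` in each form; this removes the factor lost in
`measure_le_smul_orderIntegral`. -/
lemma le_of_forall_le_inv_smul {S T : saPart L}
    (h : ∀ c : ℝ≥0, c ≠ 0 → c < 1 → S ≤ (c⁻¹ : ℝ) • T) : S ≤ T := by
  refine saPart_le_iff.2 fun x => ?_
  have h1 : ∀ c : ℝ, 0 < c → c < 1 →
      c * quadForm (S : H →L[ℂ] H) x ≤ quadForm (T : H →L[ℂ] H) x := fun c hc0 hc1 => by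
    have := saPart_le_iff.1 (h c.toNNReal (Real.toNNReal_pos.2 hc0).ne'
      (Real.toNNReal_lt_one.2 hc1)) x
    rw [Submodule.coe_smul, quadForm_smul, Real.coe_toNNReal c hc0.le] at this
    exact (le_inv_mul_iff₀ hc0).1 this
  have h2 : Tendsto (fun c : ℝ => c * quadForm (S : H →L[ℂ] H) x) (𝓝[<] 1)
      (𝓝 (1 * quadForm (S : H →L[ℂ] H) x)) :=
    (tendsto_id.mono_left nhdsWithin_le_nhds).mul_const _
  rw [one_mul] at h2
  refine le_of_tendsto h2 ?_
  filter_upwards [Ioo_mem_nhdsLT (zero_lt_one : (0 : ℝ) < 1)] with c hc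
  exact h1 c hc.1 hc.2

variable [T2Space X] [LocallyCompactSpace X] [BorelSpace X]

/-- The chain `ν(K) ≤ π(f) ≤ μ(V)` for `K ≺ f ≺ V`, followed by inner regularity of `ν` at `V`. -/
lemma IsRegularBorel.le_of_representsOn {μ ν : PosMeasure X (saPart L)}
    (hν : ν.IsRegularBorel) (hνπ : RepresentsOn ν π {f | HasCompactSupport f})
    (hμπ : RepresentsOn μ π {f | HasCompactSupport f}) {V : Set X} (hV : IsOpen V) :
    ν V ≤ μ V := by
  refine (hν.innerRegularAt V hV).2 ?_
  rintro _ ⟨K, hK, hKV, rfl⟩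
  obtain ⟨f, ⟨hfc, hf01, hf1⟩, -, -, hfs⟩ := exists_setPrec_precSet hK hV hKV
  have h1 := hνπ.orderIntegral_eq hfc fun x => (hf01 x).1
  have h2 := hμπ.orderIntegral_eq hfc fun x => (hf01 x).1
  refine le_trans ?_ (μ.orderIntegral_le_measure h2 hV.measurableSet
    (fun x => ENNReal.ofReal_le_one.2 (hf01 x).2) fun x hx => ?_)
  · have h3 : ∀ c : ℝ≥0, c ≠ 0 → c < 1 → ν K ≤ (((c⁻¹ : ℝ) • π f : saPart L) : WithTop _) :=
      fun c hc0 hc1 => ν.measure_le_smul_orderIntegral h1 hK.measurableSet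
        (fun x hx => by simp [hf1 x hx]) hc0 hc1
    obtain ⟨k, hk⟩ := WithTop.ne_top_iff_exists.1 (hν.isBorel K hK)
    rw [← hk] at h3 ⊢
    exact WithTop.coe_le_coe.2 (le_of_forall_le_inv_smul fun c hc0 hc1 =>
      WithTop.coe_le_coe.1 (h3 c hc0 hc1))
  · rw [image_eq_zero_of_notMem_tsupport fun h => hx (hfs h), ENNReal.ofReal_zero]

lemma IsRegularBorel.eq_of_representsOn {μ ν : PosMeasure X (saPart L)}
    (hν : ν.IsRegularBorel) (hμ : μ.IsRegularBorel)
    (hνπ : RepresentsOn ν π {f | HasCompactSupport f})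
    (hμπ : RepresentsOn μ π {f | HasCompactSupport f}) : ν = μ := by
  have hV : ∀ V : Set X, IsOpen V → ν V = μ V := fun V hV =>
    le_antisymm (IsRegularBorel.le_of_representsOn hν hνπ hμπ hV)
      (IsRegularBorel.le_of_representsOn hμ hμπ hνπ hV)
  refine ext_of_measurableSet fun Δ hΔ => (hν.outerRegularAt Δ hΔ).unique ?_
  have h1 : IsGLB _ _ := hμ.outerRegularAt Δ hΔ
  convert h1 using 1
  ext T
  exact exists_congr fun V => and_congr_right fun hVo => and_congr_right fun _ => by
    rw [hV V hVo]

end Uniqueness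

/-! ### The strongly closed subspaces generated by the measure and its integrals -/

section Span

open PosMeasure

section

variable {X : Type*} [MeasurableSpace X]
  {H : Type*} [NormedAddCommGroup H] [InnerProductSpace ℂ H] [CompleteSpace H]
  {L : Submodule ℂ (H →L[ℂ] H)} {μ : PosMeasure X (saPart L)}
  {𝕜 : Type*} [Semiring 𝕜] [Module 𝕜 (H →L[ℂ] H)]

/-- The integrals of both parts of `f` are strong limits of real combinations of values. The
hypothesis `hr` lets one proof serve real and complex subspaces. -/
lemma integral_mem_of_value_mem {m : H → Measure X} (h : μ.HasScalarMeasures m)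
    (hL : IsSOTClosed (L : Set (H →L[ℂ] H))) {M : Submodule 𝕜 (H →L[ℂ] H)}
    (hM : IsSOTClosed (M : Set (H →L[ℂ] H))) (hr : ∀ (r : ℝ), ∀ T ∈ M, r • T ∈ M)
    (hv : ∀ Δ, MeasurableSet Δ → (μ.value Δ : H →L[ℂ] H) ∈ M) {f : X → ℝ} (hf : f ∈ μ.L1) :
    (μ.integral f : H →L[ℂ] H) ∈ M := by
  have hmem : ∀ {g : X → ℝ≥0∞} {T : saPart L}, μ.orderIntegral g = T →
      (T : H →L[ℂ] H) ∈ M := fun hT => by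
    obtain ⟨-, -, φ, hφ⟩ := h.of_orderIntegral_eq_coe hL hT
    refine hM.mem_of_tendsto (fun n => ?_) hφ
    rw [HasScalarMeasures.elemValue, Submodule.coe_sum]
    exact M.sum_mem fun r _ => hr _ _ (hv _ ((φ n).measurableSet_preimage _))
  obtain ⟨P, N, hP, hN, hI⟩ := h.exists_parts hL hf
  rw [hI, Submodule.coe_sub, sub_eq_add_neg, ← neg_one_smul ℝ (N : H →L[ℂ] H)]
  exact M.add_mem (hmem hP) (hr _ _ (hmem hN))

end

variable {X : Type*} [TopologicalSpace X] [T2Space X] [LocallyCompactSpace X]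
  [MeasurableSpace X] [BorelSpace X]
  {H : Type*} [NormedAddCommGroup H] [InnerProductSpace ℂ H] [CompleteSpace H]
  {L : Submodule ℂ (H →L[ℂ] H)} {π : C₀(X, ℝ) →ₗ[ℝ] saPart L}
  {hπ : ∀ f : C₀(X, ℝ), (∀ x, 0 ≤ f x) → 0 ≤ π f} {μ : PosMeasure X (saPart L)}

lemma exists_tendsto_map_value (h : μ.HasScalarMeasures (scalarMeasure hπ))
    (hL : IsSOTClosed (L : Set (H →L[ℂ] H))) {Δ : Set X} (hΔ : MeasurableSet Δ) :
    ∃ g : Finset H × ℕ → C₀(X, ℝ), (∀ i, HasCompactSupport (g i)) ∧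
      ∀ x, Tendsto (fun i => (π (g i) : H →L[ℂ] H) x) atTop
        (𝓝 ((μ.value Δ : H →L[ℂ] H) x)) := by
  obtain ⟨T, hT, g, hg, hgT⟩ := exists_value hπ hL hΔ
  obtain rfl : T = μ.value Δ :=
    saPart_ext_quadForm fun x => by rw [← hT, h.real_eq x Δ hΔ]
  exact ⟨g, hg, hgT⟩

/-- For `A ⊆ B` the operator `μ(B) - μ(A)` is at most `μ(X)`, and its form is `μ_x(B \ A)`. The nets
are again indexed by finite sets of vectors and a precision. -/
lemma exists_tendsto_value (h : μ.HasScalarMeasures (scalarMeasure hπ)) {Δ : Set X}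
    (hΔ : MeasurableSet Δ) :
    ∃ K V : Finset H × ℕ → Set X, (∀ i, IsCompact (K i)) ∧ (∀ i, IsOpen (V i)) ∧
      (∀ x, Tendsto (fun i => (μ.value (K i) : H →L[ℂ] H) x) atTop
        (𝓝 ((μ.value Δ : H →L[ℂ] H) x))) ∧
      ∀ x, Tendsto (fun i => (μ.value (V i) : H →L[ℂ] H) x) atTop
        (𝓝 ((μ.value Δ : H →L[ℂ] H) x)) := by
  choose K V hK hV hKΔ hΔV hKV using fun i : Finset H × ℕ =>
    exists_compact_open_approx (scalarMeasure hπ) hΔ i.1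
      (Nat.one_div_pos_of_nat (α := ℝ) (n := i.2))
  set C := ‖(μ.value Set.univ : H →L[ℂ] H)‖
  have hmono : ∀ {A B : Set X}, MeasurableSet A → MeasurableSet B → A ⊆ B →
      μ.value A ≤ μ.value B := fun hA hB hAB => by
    rw [← WithTop.coe_le_coe, h.coe_value, h.coe_value]; exact μ.measure_mono hA hB hAB
  have key : ∀ {A B : Set X}, MeasurableSet A → MeasurableSet B → A ⊆ B → ∀ (x : H) (n : ℕ),
      (scalarMeasure hπ x).real (B \ A) ≤ 1 / ((n : ℝ) + 1) →
      ‖(μ.value B : H →L[ℂ] H) x - (μ.value A : H →L[ℂ] H) x‖ ^ 2 ≤ C / ((n : ℝ) + 1) := by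
    intro A B hA hB hAB x n hn
    have h1 := saPart_norm_apply_sub_sq_le (hmono hA hB hAB)
      ((sub_le_self _ (h.value_nonneg A)).trans (hmono hB .univ (Set.subset_univ B))) x
    refine h1.trans ?_
    rw [← h.real_eq x A hA, ← h.real_eq x B hB, ← measureReal_sdiff hAB hA, div_eq_mul_one_div]
    exact mul_le_mul_of_nonneg_left hn (norm_nonneg _)
  refine ⟨K, V, hK, hV, tendsto_of_norm_sq_le (C := C) fun F n x hx => ?_,
    tendsto_of_norm_sq_le (C := C) fun F n x hx => ?_⟩
  · rw [norm_sub_rev]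
    refine key (hK _).measurableSet hΔ (hKΔ _) x n ?_
    exact (measureReal_mono (Set.sdiff_subset_sdiff_left (hΔV _))).trans (hKV (F, n) x hx)
  · refine key hΔ (hV _).measurableSet (hΔV _) x n ?_
    exact (measureReal_mono (Set.sdiff_subset_sdiff_right (hKΔ _))).trans (hKV (F, n) x hx)

variable {𝕜 : Type*} [Semiring 𝕜] [Module 𝕜 (H →L[ℂ] H)]

/-- Index `3`, the integrals of `L1` functions, contains the other six sets. Conversely each of the
seven closed spans contains every `μ(Δ)`, by the strong approximations, and hence every integral. -/
lemma sotSpan_sevenSets (h : μ.HasScalarMeasures (scalarMeasure hπ))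
    (hL : IsSOTClosed (L : Set (H →L[ℂ] H)))
    (hr : ∀ (M : Submodule 𝕜 (H →L[ℂ] H)) (r : ℝ), ∀ T ∈ M, r • T ∈ M) (i j : Fin 7) :
    sotSpan 𝕜 (sevenSets π μ i) = sotSpan 𝕜 (sevenSets π μ j) := by
  have hrep := representsOn_of_hasScalarMeasures h hL Set.univ
  have hbdd : ∀ Δ, MeasurableSet Δ → (∀ x, |Δ.indicator (1 : X → ℝ) x| ≤ 1) ∧
      Measurable (Δ.indicator (1 : X → ℝ)) := fun Δ hΔ =>
    ⟨fun x => by by_cases hx : x ∈ Δ <;> simp [hx], measurable_one.indicator hΔ⟩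
  have hind : ∀ Δ, MeasurableSet Δ → (μ.value Δ : H →L[ℂ] H) ∈ sevenSets π μ 3 := fun Δ hΔ =>
    ⟨_, h.mem_L1_of_bounded hL (hbdd Δ hΔ).2 (hbdd Δ hΔ).1,
      by rw [h.integral_indicator_one hL hΔ]⟩
  have hsub : ∀ k, sevenSets π μ k ⊆ sevenSets π μ 3 := by
    intro k
    fin_cases k
    · rintro _ ⟨f, -, rfl⟩
      exact ⟨f, (hrep f trivial).1, congrArg Subtype.val (hrep f trivial).2⟩
    · rintro _ ⟨f, rfl⟩
      exact ⟨f, (hrep f trivial).1, congrArg Subtype.val (hrep f trivial).2⟩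
    · rintro _ ⟨f, hf, ⟨C, hC⟩, rfl⟩
      exact ⟨f, h.mem_L1_of_bounded hL hf hC, rfl⟩
    · exact subset_rfl
    · rintro _ ⟨V, hV, rfl⟩
      exact hind V hV.measurableSet
    · rintro _ ⟨K, hK, rfl⟩
      exact hind K hK.measurableSet
    · rintro _ ⟨Δ, hΔ, rfl⟩
      exact hind Δ hΔ
  have hval : ∀ k Δ, MeasurableSet Δ →
      (μ.value Δ : H →L[ℂ] H) ∈ sotSpan 𝕜 (sevenSets π μ k) := by
    intro k Δ hΔ
    classical
    have hcl := isSOTClosed_sotSpan (𝕜 := 𝕜) (sevenSets π μ k)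
    have hss := subset_sotSpan (𝕜 := 𝕜) (sevenSets π μ k)
    obtain ⟨g, hg, hgΔ⟩ := exists_tendsto_map_value h hL hΔ
    obtain ⟨K, V, hK, hV, hKΔ, hVΔ⟩ := exists_tendsto_value h hΔ
    fin_cases k
    · exact hcl.mem_of_tendsto (fun i => hss ⟨g i, hg i, rfl⟩) hgΔ
    · exact hcl.mem_of_tendsto (fun i => hss ⟨g i, rfl⟩) hgΔ
    · exact hss ⟨_, (hbdd Δ hΔ).2, ⟨1, (hbdd Δ hΔ).1⟩, by rw [h.integral_indicator_one hL hΔ]⟩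
    · exact hss (hind Δ hΔ)
    · exact hcl.mem_of_tendsto (fun i => hss ⟨V i, hV i, rfl⟩) hVΔ
    · exact hcl.mem_of_tendsto (fun i => hss ⟨K i, hK i, rfl⟩) hKΔ
    · exact hss ⟨Δ, hΔ, rfl⟩
  have heq : ∀ k, sotSpan 𝕜 (sevenSets π μ k) = sotSpan 𝕜 (sevenSets π μ 3) := fun k => by
    refine le_antisymm
      (sotSpan_le (isSOTClosed_sotSpan _) ((hsub k).trans (subset_sotSpan _)))
      (sotSpan_le (isSOTClosed_sotSpan _) ?_)
    rintro _ ⟨f, hf, rfl⟩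
    exact integral_mem_of_value_mem h hL (isSOTClosed_sotSpan _) (hr _) (hval k) hf
  rw [heq i, heq j]

end Span

end OrderRiesz

end

/-! ### Assembly of the theorem -/

theorem mainTheorem7
    {X : Type*} [TopologicalSpace X] [T2Space X] [LocallyCompactSpace X]
    [MeasurableSpace X] [BorelSpace X]
    {H : Type*} [NormedAddCommGroup H] [InnerProductSpace ℂ H] [CompleteSpace H]
    (π : C₀(X, ℝ) →ₗ[ℝ] selfAdjoint (H →L[ℂ] H))
    (hπ : ∀ f : C₀(X, ℝ), (∀ x, 0 ≤ f x) → 0 ≤ π f)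
    (L : Submodule ℂ (H →L[ℂ] H))
    (hLclosed : OrderRiesz.IsSOTClosed (L : Set (H →L[ℂ] H)))
    (hL : ∀ f, (π f : H →L[ℂ] H) ∈ L) :
    ∃ μ : OrderRiesz.PosMeasure X (OrderRiesz.saPart L),
      -- `μ` is a regular Borel measure that represents `π` on `C_c(X)`, and it is the only one
      (μ.IsRegularBorel ∧
        OrderRiesz.RepresentsOn μ (OrderRiesz.toSaPart L π hL) {f | HasCompactSupport f}) ∧
      (∀ ν : OrderRiesz.PosMeasure X (OrderRiesz.saPart L), ν.IsRegularBorel →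
        OrderRiesz.RepresentsOn ν (OrderRiesz.toSaPart L π hL) {f | HasCompactSupport f} →
        ν = μ) ∧
      -- it is finite and represents `π` on `C₀(X)`
      μ.IsFinite ∧
      OrderRiesz.RepresentsOn μ (OrderRiesz.toSaPart L π hL) Set.univ ∧
      -- the measures of open and of compact sets; supremum and infimum are taken in `L_sa`
      (∀ V : Set X, IsOpen V → V.Nonempty →
        ∃ T : OrderRiesz.saPart L, μ V = (T : WithTop (OrderRiesz.saPart L)) ∧
          IsLUB (OrderRiesz.toSaPart L π hL '' {f | OrderRiesz.PrecSet f V}) T) ∧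
      (∀ K : Set X, IsCompact K →
        ∃ T : OrderRiesz.saPart L, μ K = (T : WithTop (OrderRiesz.saPart L)) ∧
          IsGLB (OrderRiesz.toSaPart L π hL '' {f | OrderRiesz.SetPrec K f}) T) ∧
      -- strong σ-additivity
      (∀ Δ : ℕ → Set X, (∀ n, MeasurableSet (Δ n)) → Pairwise (Function.onFun Disjoint Δ) →
        ∀ x : H, HasSum (fun n => (μ.value (Δ n) : H →L[ℂ] H) x)
          ((μ.value (⋃ n, Δ n) : H →L[ℂ] H) x)) ∧
      -- the regular Borel measures `μ_x` and the extension of `π` to `L1`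
      (∃ m : H → Measure X,
        (∀ x, IsFiniteMeasure (m x) ∧ (m x).Regular ∧
          ∀ Δ : Set X, MeasurableSet Δ →
            (((m x).real Δ : ℝ) : ℂ) = inner ℂ x ((μ.value Δ : H →L[ℂ] H) x)) ∧
        ∀ f ∈ μ.L1, (∀ x, Integrable f (m x)) ∧
          ∀ T : H →L[ℂ] H,
            (∀ x, inner ℂ x (T x) = ((∫ y, f y ∂(m x) : ℝ) : ℂ)) ↔ T = μ.integral f) ∧
      -- the seven SOT-closed real, and the seven SOT-closed complex, subspaces coincide
      (∀ i j : Fin 7,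
        OrderRiesz.sotSpan ℝ (OrderRiesz.sevenSets (OrderRiesz.toSaPart L π hL) μ i) =
          OrderRiesz.sotSpan ℝ (OrderRiesz.sevenSets (OrderRiesz.toSaPart L π hL) μ j)) ∧
      (∀ i j : Fin 7,
        OrderRiesz.sotSpan ℂ (OrderRiesz.sevenSets (OrderRiesz.toSaPart L π hL) μ i) =
          OrderRiesz.sotSpan ℂ (OrderRiesz.sevenSets (OrderRiesz.toSaPart L π hL) μ j)) := by
  set Φ := OrderRiesz.toSaPart L π hL
  -- Positivity carries over as it stands: both orders are the operator order of `B(H)`.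
  have hΦ : ∀ f : C₀(X, ℝ), (∀ x, 0 ≤ f x) → 0 ≤ Φ f := hπ
  have h := OrderRiesz.hasScalarMeasures_representingMeasure hΦ hLclosed
  set μ := OrderRiesz.representingMeasure hΦ hLclosed
  have hreg := OrderRiesz.isRegularBorel_of_hasScalarMeasures h
  have hrep := OrderRiesz.representsOn_of_hasScalarMeasures h hLclosed
  refine ⟨μ, ⟨hreg, hrep _⟩, fun ν hν hνπ => ?_, h.ne_top _, hrep _, fun V hV _ => ?_,
    fun K hK => ?_, fun Δ hΔ hd x => h.hasSum_value_apply hΔ hd x,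
    ⟨OrderRiesz.scalarMeasure hΦ, fun x => ⟨inferInstance, inferInstance, fun Δ hΔ => ?_⟩,
      fun f hf => ⟨h.integrable_of_mem_L1 hLclosed hf, h.eq_integral_iff hLclosed hf⟩⟩, ?_, ?_⟩
  · exact OrderRiesz.IsRegularBorel.eq_of_representsOn hν hreg hνπ (hrep _)
  · exact ⟨μ.value V, (h.coe_value V).symm, OrderRiesz.isLUB_map_precSet h hV⟩
  · exact ⟨μ.value K, (h.coe_value K).symm, OrderRiesz.isGLB_map_setPrec h hK⟩
  · rw [h.real_eq x Δ hΔ, OrderRiesz.inner_eq_quadForm (OrderRiesz.isSelfAdjoint_of_saPart _)]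
  · exact OrderRiesz.sotSpan_sevenSets h hLclosed fun M r T hT => M.smul_mem r hT
  · exact OrderRiesz.sotSpan_sevenSets h hLclosed fun M r T hT => by
      rw [← Complex.coe_smul]; exact M.smul_mem (r : ℂ) hT
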